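/- Let $F$ be a totally real number field, $E=F(\zeta_3)$ with $\zeta_3$ a primitive third root of unity, and let $L\supset E$ be an extension field such that $L/F$ is Galois with cyclic Galois group of order $6$. Let $\tau$ be the element of order $2$ of $\mathrm{Gal}(L/F)$ (also written $x\mapsto\bar x$; it restricts to the non-trivial automorphism of $E/F$), $M=L^{\tau}$, and let $\rho$ be a non-trivial element of $\mathrm{Gal}(L/E)$. Let $a\in\mathfrak o_E^\times$ and $b\in\mathfrak o_F^\times$ satisfy $N_{E/F}(a)=N_{M/F}(b)$, and assume that the cyclic algebra $$D=L\oplus Lz\oplus Lz^2,\qquad z^3=a,\quad zl=\rho(l)z\ \ (l\in L),$$ is a division algebra. Let $\alpha$ be the involution of the second kind on $D$ with $\alpha|_L=\tau$ and $\alpha(z)=\frac ba z^2$, let $N_{rd}$ be the reduced norm of $D$, and let $\rho$ act on $D$ by $\rho(l_0+l_1z+l_2z^2)=\rho(l_0)+\rho(l_1)z+\rho(l_2)z^2$. For a set $S$ of prime ideals of $F$ let $\mathfrak o_F(S)\subset F$ be the subring of $F$ in which exactly the primes in $S$ are invertible, $\mathfrak o_L(S)=\mathfrak o_L\cdot\mathfrak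 o_F(S)\subset L$, and $$\mathbb G(\mathfrak o_F(S))=\{g=l_0+l_1z+l_2z^2\in D\;:\; l_0,l_1,l_2\in\mathfrak o_L(S),\ \alpha(g)g=1,\ N_{rd}(g)=1\}.$$ Then for every set $S$ of prime ideals of $F$ each of which is either ramified in $E$, or unramified and non-split in $E$ and does not divide $3$, the group of $\rho$-fixed points is $$\mathbb G(\mathfrak o_F(S))^{\rho}=\{1,\zeta_3,\bar\zeta_3\}.$$ -/

import Mathlib

open NumberField IsDedekindDomain

/-- The data of a special cyclic presentation for a tower of fields `L / E / F`: the extension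
`E / F` is quadratic, `L / F` is cyclic Galois of degree six, `ρ` is a non-trivial element of
`Gal(L/E)`, `τ` is the element of order two of `Gal(L/F)` (it restricts to the non-trivial
automorphism of `E / F`), `M = L^τ`, and the constants `a ∈ Eˣ`, `b ∈ M` satisfy
`N_{E/F}(a) = N_{M/F}(b)`. -/
structure CyclicPresentation (F E L : Type*) [Field F] [Field E] [Field L]
    [Algebra F E] [Algebra E L] [Algebra F L] [IsScalarTower F E L] where
  finrank_E : Module.finrank F E = 2
  finrank_L : Module.finrank F L = 6
  isGalois : IsGalois F L
  isCyclic : IsCyclic (L ≃ₐ[F] L)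
  ρ : L ≃ₐ[E] L
  ρ_ne_one : ρ ≠ 1
  τ : L ≃ₐ[F] L
  orderOf_τ : orderOf τ = 2
  a : Eˣ
  b : IntermediateField.fixedField (Subgroup.zpowers τ)
  norm_eq : Algebra.norm F (a : E) = Algebra.norm F b

namespace CyclicPresentation

section

variable {F E L : Type*} [Field F] [Field E] [Field L]
  [Algebra F E] [Algebra E L] [Algebra F L] [IsScalarTower F E L]

/-- The constant `a`, as an element of `L`. -/
def aL (P : CyclicPresentation F E L) : L := algebraMap E L P.a

/-- The constant `b`, as an element of `L`. -/
def bL (P : CyclicPresentation F E L) : L := (P.b : L)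

theorem finiteDimensional_L (P : CyclicPresentation F E L) : FiniteDimensional F L :=
  FiniteDimensional.of_finrank_pos (by rw [P.finrank_L]; norm_num)

theorem finrank_EL (P : CyclicPresentation F E L) : Module.finrank E L = 3 := by
  have := P.finiteDimensional_L
  have h := Module.finrank_mul_finrank F E L
  rw [P.finrank_E, P.finrank_L] at h
  omega

theorem isGalois_EL (P : CyclicPresentation F E L) : IsGalois E L := by
  have := P.isGalois
  exact IsGalois.tower_top_of_isGalois F E L

theorem card_gal_EL (P : CyclicPresentation F E L) : Nat.card (L ≃ₐ[E] L) = 3 := by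
  have := P.isGalois_EL
  have : FiniteDimensional E L :=
    FiniteDimensional.of_finrank_pos (by rw [P.finrank_EL]; norm_num)
  rw [IsGalois.card_aut_eq_finrank, P.finrank_EL]

theorem ρ_pow_three (P : CyclicPresentation F E L) : P.ρ ^ 3 = 1 := by
  have := pow_card_eq_one' (x := P.ρ)
  rwa [P.card_gal_EL] at this

theorem ρ_ρ_ρ (P : CyclicPresentation F E L) (x : L) : P.ρ (P.ρ (P.ρ x)) = x := by
  have := congrArg (fun f : L ≃ₐ[E] L => f x) P.ρ_pow_three
  simpa [pow_succ] using this

theorem τ_τ (P : CyclicPresentation F E L) (x : L) : P.τ (P.τ x) = x := by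
  have h : P.τ ^ 2 = 1 := P.orderOf_τ ▸ pow_orderOf_eq_one P.τ
  have := congrArg (fun f : L ≃ₐ[F] L => f x) h
  simpa [pow_succ] using this

theorem τ_ρ (P : CyclicPresentation F E L) (x : L) : P.τ (P.ρ x) = P.ρ (P.τ x) := by
  have := P.isCyclic
  let _ : CommGroup (L ≃ₐ[F] L) := IsCyclic.commGroup
  have h : P.τ * P.ρ.restrictScalars F = P.ρ.restrictScalars F * P.τ := mul_comm _ _
  exact congrArg (fun f : L ≃ₐ[F] L => f x) h

theorem ρ_aL (P : CyclicPresentation F E L) : P.ρ P.aL = P.aL := P.ρ.commutes _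

theorem aL_ne_zero (P : CyclicPresentation F E L) : P.aL ≠ 0 := by simp [aL]

theorem τ_bL (P : CyclicPresentation F E L) : P.τ P.bL = P.bL := P.b.2 ⟨P.τ, Subgroup.mem_zpowers P.τ⟩

theorem ρ_τ_aL (P : CyclicPresentation F E L) : P.ρ (P.τ P.aL) = P.τ P.aL := by rw [← P.τ_ρ, P.ρ_aL]

theorem prod_gal_eq {K : Type*} [Field K] [Algebra F K] [FiniteDimensional F K] [IsGalois F K]
    (g : K ≃ₐ[F] K) (p : ℕ) [Fact p.Prime] (hp : Module.finrank F K = p) (hg : g ≠ 1) (x : K) :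
    algebraMap F K (Algebra.norm F x) = ∏ i ∈ Finset.range p, (g ^ i) x := by
  classical
  have hc : Nat.card (K ≃ₐ[F] K) = p := by rw [IsGalois.card_aut_eq_finrank, hp]
  have ho : orderOf g = p := by
    refine orderOf_eq_prime ?_ hg
    rw [← hc]
    exact pow_card_eq_one'
  have hz : ∀ y : K ≃ₐ[F] K, y ∈ Subgroup.zpowers g := fun y =>
    mem_zpowers_of_prime_card hc hg
  rw [Algebra.norm_eq_prod_automorphisms, ← IsCyclic.image_range_orderOf hz, ho,
    Finset.prod_image]
  intro i hi j hj hij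
  rw [← ho] at hi hj
  exact pow_injOn_Iio_orderOf (by simpa using hi) (by simpa using hj) hij

theorem aL_mul_τ_aL (P : CyclicPresentation F E L) :
    P.aL * P.τ P.aL = algebraMap F L (Algebra.norm F (P.a : E)) := by
  have := P.isGalois
  have := P.finiteDimensional_L
  have : Algebra.IsQuadraticExtension F E :=
    { finrank_eq_two' := P.finrank_E }
  have : FiniteDimensional F E :=
    FiniteDimensional.of_finrank_pos (by rw [P.finrank_E]; norm_num)
  have : Algebra.IsSeparable F E := Algebra.isSeparable_tower_bot_of_isSeparable F E L
  have : IsGalois F E := inferInstance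
  have hne : P.τ.restrictNormal E ≠ 1 := by
    intro h
    have hfix : ∀ e : E, P.τ (algebraMap E L e) = algebraMap E L e := fun e => by
      rw [← AlgEquiv.restrictNormal_commutes, h]; rfl
    let t : L ≃ₐ[E] L := AlgEquiv.ofRingEquiv (f := P.τ.toRingEquiv) hfix
    have h2 : t ^ 2 = 1 := by
      ext x
      exact P.τ_τ x
    have h3 : t ^ 3 = 1 := by
      have := pow_card_eq_one' (x := t)
      rwa [P.card_gal_EL] at this
    have h1 : t = 1 := by
      rwa [pow_succ, h2, one_mul] at h3
    have : P.τ = 1 := by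
      ext x
      exact congrArg (fun f : L ≃ₐ[E] L => f x) h1
    have h' := P.orderOf_τ
    rw [this, orderOf_one] at h'
    omega
  rw [IsScalarTower.algebraMap_apply F E L,
    prod_gal_eq (P.τ.restrictNormal E) 2 P.finrank_E hne]
  simp [Finset.prod_range_succ, aL, AlgEquiv.restrictNormal_commutes]

theorem bL_mul (P : CyclicPresentation F E L) :
    P.bL * P.ρ P.bL * P.ρ (P.ρ P.bL) = algebraMap F L (Algebra.norm F P.b) := by
  have := P.isGalois
  have := P.isCyclic
  have := P.finiteDimensional_L
  let _ : CommGroup (L ≃ₐ[F] L) := IsCyclic.commGroup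
  have hn : (Subgroup.zpowers P.τ).Normal := inferInstance
  have : IsGalois F (IntermediateField.fixedField (Subgroup.zpowers P.τ)) :=
    IsGalois.of_fixedField_normal_subgroup _
  have hM : Module.finrank F (IntermediateField.fixedField (Subgroup.zpowers P.τ)) = 3 := by
    have h1 := IntermediateField.finrank_fixedField_eq_card (Subgroup.zpowers P.τ)
    rw [Nat.card_zpowers, P.orderOf_τ] at h1
    have h2 := Module.finrank_mul_finrank F
      (IntermediateField.fixedField (Subgroup.zpowers P.τ)) L
    rw [h1, P.finrank_L] at h2
    omega
  let r : L ≃ₐ[F] L := P.ρ.restrictScalars F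
  have hr3 : r ^ 3 = 1 := by
    ext x
    exact P.ρ_ρ_ρ x
  have hne : r.restrictNormal (IntermediateField.fixedField (Subgroup.zpowers P.τ)) ≠ 1 := by
    intro h
    have hfix : ∀ m : IntermediateField.fixedField (Subgroup.zpowers P.τ), r m = m := fun m => by
      have := AlgEquiv.restrictNormal_commutes r
        (IntermediateField.fixedField (Subgroup.zpowers P.τ)) m
      rw [h] at this
      exact this.symm
    have hmem : r ∈ IntermediateField.fixingSubgroup
        (IntermediateField.fixedField (Subgroup.zpowers P.τ)) :=
      (IntermediateField.mem_fixingSubgroup_iff _ _).2 fun x hx => hfix ⟨x, hx⟩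
    rw [IntermediateField.fixingSubgroup_fixedField] at hmem
    obtain ⟨k, hk⟩ := hmem
    have hr2 : r ^ 2 = 1 := by
      rw [← hk]
      ext x
      have : (P.τ ^ k) ^ 2 = 1 := by
        rw [← zpow_natCast, ← zpow_mul, mul_comm, zpow_mul, zpow_natCast]
        have : P.τ ^ 2 = 1 := P.orderOf_τ ▸ pow_orderOf_eq_one P.τ
        rw [this, one_zpow]
      exact congrArg (fun f : L ≃ₐ[F] L => f x) this
    have h1 : r = 1 := by rwa [pow_succ, hr2, one_mul] at hr3
    apply P.ρ_ne_one
    ext x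
    exact congrArg (fun f : L ≃ₐ[F] L => f x) h1
  rw [IsScalarTower.algebraMap_apply F (IntermediateField.fixedField (Subgroup.zpowers P.τ)) L,
    prod_gal_eq (r.restrictNormal _) 3 hM hne]
  have hc := AlgEquiv.restrictNormal_commutes r
        (IntermediateField.fixedField (Subgroup.zpowers P.τ))
  simp only [Finset.prod_range_succ, Finset.prod_range_zero, one_mul, map_mul, pow_succ, pow_zero,
    AlgEquiv.mul_apply, AlgEquiv.one_apply, hc]
  rfl

theorem norm_eq' (P : CyclicPresentation F E L) : P.aL * P.τ P.aL = P.bL * P.ρ P.bL * P.ρ (P.ρ P.bL) := by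
  rw [P.aL_mul_τ_aL, P.bL_mul, P.norm_eq]

end

/-- The cyclic algebra `D = L ⊕ L z ⊕ L z²`; the triple `(l₀, l₁, l₂)` stands for
`l₀ + l₁ z + l₂ z²`. -/
@[ext]
structure Alg {F E L : Type*} [Field F] [Field E] [Field L]
    [Algebra F E] [Algebra E L] [Algebra F L] [IsScalarTower F E L]
    (P : CyclicPresentation F E L) where
  l₀ : L
  l₁ : L
  l₂ : L

namespace Alg

section

variable {F E L : Type*} [Field F] [Field E] [Field L]
  [Algebra F E] [Algebra E L] [Algebra F L] [IsScalarTower F E L]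
  {P : CyclicPresentation F E L}

instance : Zero P.Alg := ⟨⟨0, 0, 0⟩⟩
instance : One P.Alg := ⟨⟨1, 0, 0⟩⟩
instance : Add P.Alg := ⟨fun x y => ⟨x.l₀ + y.l₀, x.l₁ + y.l₁, x.l₂ + y.l₂⟩⟩
instance : Neg P.Alg := ⟨fun x => ⟨-x.l₀, -x.l₁, -x.l₂⟩⟩

/-- The product determined by `z³ = a` and `z l = ρ(l) z` for `l ∈ L`. -/
instance : Mul P.Alg := ⟨fun x y =>
  ⟨x.l₀ * y.l₀ + P.aL * (x.l₁ * P.ρ y.l₂ + x.l₂ * P.ρ (P.ρ y.l₁)),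
   x.l₀ * y.l₁ + x.l₁ * P.ρ y.l₀ + P.aL * (x.l₂ * P.ρ (P.ρ y.l₂)),
   x.l₀ * y.l₂ + x.l₁ * P.ρ y.l₁ + x.l₂ * P.ρ (P.ρ y.l₀)⟩⟩

@[simp] theorem zero_l₀ : (0 : P.Alg).l₀ = 0 := rfl
@[simp] theorem zero_l₁ : (0 : P.Alg).l₁ = 0 := rfl
@[simp] theorem zero_l₂ : (0 : P.Alg).l₂ = 0 := rfl
@[simp] theorem one_l₀ : (1 : P.Alg).l₀ = 1 := rfl
@[simp] theorem one_l₁ : (1 : P.Alg).l₁ = 0 := rfl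
@[simp] theorem one_l₂ : (1 : P.Alg).l₂ = 0 := rfl
@[simp] theorem add_l₀ (x y : P.Alg) : (x + y).l₀ = x.l₀ + y.l₀ := rfl
@[simp] theorem add_l₁ (x y : P.Alg) : (x + y).l₁ = x.l₁ + y.l₁ := rfl
@[simp] theorem add_l₂ (x y : P.Alg) : (x + y).l₂ = x.l₂ + y.l₂ := rfl
@[simp] theorem neg_l₀ (x : P.Alg) : (-x).l₀ = -x.l₀ := rfl
@[simp] theorem neg_l₁ (x : P.Alg) : (-x).l₁ = -x.l₁ := rfl
@[simp] theorem neg_l₂ (x : P.Alg) : (-x).l₂ = -x.l₂ := rfl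
@[simp] theorem mul_l₀ (x y : P.Alg) : (x * y).l₀ =
    x.l₀ * y.l₀ + P.aL * (x.l₁ * P.ρ y.l₂ + x.l₂ * P.ρ (P.ρ y.l₁)) := rfl
@[simp] theorem mul_l₁ (x y : P.Alg) : (x * y).l₁ =
    x.l₀ * y.l₁ + x.l₁ * P.ρ y.l₀ + P.aL * (x.l₂ * P.ρ (P.ρ y.l₂)) := rfl
@[simp] theorem mul_l₂ (x y : P.Alg) : (x * y).l₂ =
    x.l₀ * y.l₂ + x.l₁ * P.ρ y.l₁ + x.l₂ * P.ρ (P.ρ y.l₀) := rfl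

instance : Ring P.Alg where
  add_assoc x y z := by ext <;> simp [add_assoc]
  zero_add x := by ext <;> simp
  add_zero x := by ext <;> simp
  add_comm x y := by ext <;> simp [add_comm]
  neg_add_cancel x := by ext <;> simp
  mul_assoc x y z := by
    ext <;> simp [P.ρ_ρ_ρ, P.ρ_aL] <;> ring
  one_mul x := by ext <;> simp
  mul_one x := by ext <;> simp
  zero_mul x := by ext <;> simp
  mul_zero x := by ext <;> simp
  left_distrib x y z := by ext <;> simp <;> ring
  right_distrib x y z := by ext <;> simp <;> ring
  nsmul := nsmulRec
  zsmul := zsmulRec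

/-- The involution `α` of the second kind with `α|_L = τ` and `α(z) = (b/a) z²`, so that
`α(l₀ + l₁ z + l₂ z²) = τ(l₀) + α(z) τ(l₁) + α(z)² τ(l₂)`. -/
instance : StarRing P.Alg where
  star x :=
    ⟨P.τ x.l₀,
     P.bL * P.ρ (P.ρ P.bL) / P.aL * P.ρ (P.τ x.l₂),
     P.bL / P.aL * P.ρ (P.ρ (P.τ x.l₁))⟩
  star_involutive x := by
    have ha := P.aL_ne_zero
    have hb := P.norm_eq'
    have hta : P.τ P.aL ≠ 0 := by simpa using ha
    ext <;> simp [P.τ_ρ, P.τ_τ, P.ρ_ρ_ρ, P.τ_bL, P.ρ_τ_aL]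
    · field_simp
      linear_combination (-x.l₁) * hb
    · field_simp
      linear_combination (-x.l₂) * hb
  star_mul x y := by
    have ha := P.aL_ne_zero
    have hb := P.norm_eq'
    ext <;> simp [P.τ_ρ, P.ρ_ρ_ρ, P.ρ_τ_aL, P.ρ_aL] <;> field_simp
    · linear_combination (P.τ x.l₁ * P.ρ (P.τ y.l₂) + P.τ x.l₂ * P.ρ (P.ρ (P.τ y.l₁))) * hb
    · ring
    · linear_combination P.bL * P.ρ (P.ρ (P.τ x.l₂)) * P.ρ (P.τ y.l₂) * hb
  star_add x y := by ext <;> simp <;> ring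

/-- The embedding of `L` into `D`. -/
def ofL (P : CyclicPresentation F E L) (l : L) : P.Alg := ⟨l, 0, 0⟩

/-- The embedding of `D` into `M₃(L)`, given on `L` by `l ↦ diag(l, ρ(l), ρ²(l))` and sending `z`
to the matrix with rows `(0,1,0)`, `(0,0,1)`, `(a,0,0)`. -/
def toMatrix (g : P.Alg) : Matrix (Fin 3) (Fin 3) L :=
  !![g.l₀, g.l₁, g.l₂;
     P.aL * P.ρ g.l₂, P.ρ g.l₀, P.ρ g.l₁;
     P.aL * P.ρ (P.ρ g.l₁), P.aL * P.ρ (P.ρ g.l₂), P.ρ (P.ρ g.l₀)]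

/-- The reduced norm of `D` (with values in `E ⊆ L`). -/
def reducedNorm (g : P.Alg) : L := g.toMatrix.det

/-- The action of `ρ` on the coefficients: `ρ(l₀ + l₁ z + l₂ z²) = ρ(l₀) + ρ(l₁) z + ρ(l₂) z²`. -/
def rhoAct (g : P.Alg) : P.Alg := ⟨P.ρ g.l₀, P.ρ g.l₁, P.ρ g.l₂⟩

end

end Alg

section

variable {F E L : Type*} [Field F] [Field E] [Field L] [NumberField F]
  [Algebra F E] [Algebra E L] [Algebra F L] [IsScalarTower F E L]

/-- `𝔬_L(S) = 𝔬_L · 𝔬_F(S)`: the `𝔬_F(S)`-submodule of `L` generated by `𝔬_L`, where `𝔬_F(S)` is the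
ring of `S`-integers of `F`, the subring of `F` in which exactly the primes in `S` are inverted. -/
noncomputable def integersL (F L : Type*) [Field F] [Field L] [NumberField F] [Algebra F L]
    (S : Set (HeightOneSpectrum (𝓞 F))) : Submodule (S.integer F) L :=
  Submodule.span (S.integer F) (Set.range (algebraMap (𝓞 L) L))

/-- The set `𝔾(𝔬_F(S))` of `𝔬_F(S)`-valued points of the special unitary group: the elements `g` of
`Λ ⊗ 𝔬_F(S)`, where `Λ = 𝔬_L ⊕ 𝔬_L z ⊕ 𝔬_L z²`, with `α(g) g = 1` and reduced norm one. -/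
def specialUnitaryPoints (P : CyclicPresentation F E L) (S : Set (HeightOneSpectrum (𝓞 F))) :
    Set P.Alg :=
  {g | (g.l₀ ∈ integersL F L S ∧ g.l₁ ∈ integersL F L S ∧ g.l₂ ∈ integersL F L S) ∧
    star g * g = 1 ∧ g.reducedNorm = 1}

end

end CyclicPresentation

section

variable {F : Type*} (E : Type*) [Field F] [Field E] [NumberField F] [Algebra F E]

/-- The prime `p` of `F` is ramified in `E`: it is divisible by the square of a prime of `E`. -/
def RamifiedIn (p : HeightOneSpectrum (𝓞 F)) : Prop :=
  ∃ P ∈ p.asIdeal.primesOver (𝓞 E), p.asIdeal.map (algebraMap (𝓞 F) (𝓞 E)) ≤ P ^ 2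

/-- The prime `p` of `F` is non-split in `E`: there is exactly one prime of `E` above it. -/
def NonSplitIn (p : HeightOneSpectrum (𝓞 F)) : Prop :=
  ∃! P : Ideal (𝓞 E), P ∈ p.asIdeal.primesOver (𝓞 E)

end

/-!
The `ρ`-fixed elements of the division algebra `D` are those with coordinates in `E`. They form the
field `K = E(z)`, `z ^ 3 = a`, a cubic extension of `E` because a cube `a` would produce zero
divisors in `D`. Let `σ` be the generator `z ↦ ζ z` of `Gal(K/E)`. The involution restricts to an
automorphism `α` of `K` with `α z = b / z`, it commutes with `σ`, and the reduced norm restricts to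
the norm `k ↦ k * σ k * σ (σ k)`. So one has to find the elements `k` of `K` with `α k * k = 1` and
norm one whose coordinates are integral over the `S`-integers of `F`.

Such a `k` is a root of unity by Kronecker's theorem. Since `F` is totally real, `α` is complex
conjugation in every embedding (`PureCubic.conj_embedding`), so that all conjugates of `k` have
absolute value one. Moreover `k` is integral (`PureCubic.isIntegral_of_α_mul_self`): a prime `w` of
`K` above a non-split prime of `F` satisfies `α w = w`, as `α w = σ ^ i w` for some `i` and `α`, `σ`
commute and have coprime orders; then `k` and `α k = k⁻¹` have the same valuation at `w`.

It remains to show `k ^ 3 = 1` (`PureCubic.pow_three_eq_one`). A power `h = k ^ (3 ^ r)` has order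
prime to three, and hence is determined by its residue modulo a prime `w` of `K` above three. Let `p`
be the prime of `F` below `w`.
* If `p ∉ S`, the coordinates of `k` are integral at `p`, and `ζ ≡ 1` modulo `w` gives
  `σ k ≡ k`, so that `σ h = h`, the norm of `h` is `h ^ 3`, and `h = 1`.
* If `p ∈ S`, then `p` is ramified in `E`, so that `τ` acts trivially on the residue field of `E`
  at `p` (`sub_conj_mem_of_ramified`). Hence `h⁻¹ = α h` is congruent modulo `w`, and so equal, to
  one of the conjugates `σ ^ i h`; since `σ` has order three, `h⁻¹ = h`, and `h = 1` by the norm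
  condition (`PureCubic.eq_one_of_trivial_action`).

Finally, a root of unity of `3`-power order and norm one satisfies `k ^ 3 = 1`, by Kummer theory
(`PureCubic.pow_three_eq_one_of_norm_eq_one`). The cube roots of unity in `K` are the powers of `ζ`.
-/

/-! ### Primes in quadratic extensions -/

section Quadratic

variable {F E : Type*} [Field F] [Field E] [Algebra F E]

theorem exists_ringOfIntegers_of_fixed {τ : E ≃+* E}
    (hfix : ∀ x, τ x = x → x ∈ Set.range (algebraMap F E)) {x : 𝓞 E}
    (hx : τ (x : E) = x) : ∃ y : 𝓞 F, algebraMap (𝓞 F) (𝓞 E) y = x := by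
  obtain ⟨y, hy⟩ := hfix _ hx
  have hi : IsIntegral ℤ y := by
    rw [← isIntegral_algebraMap_iff (algebraMap F E).injective, hy]
    exact x.2
  exact ⟨⟨y, hi⟩, RingOfIntegers.ext hy⟩

/-- An integer of `E` that is fixed by `τ` and lies in a prime `Q` above `p` lies in every ideal
that contains `p`. -/
theorem mem_of_fixed_of_mem {τ : E ≃+* E}
    (hfix : ∀ x, τ x = x → x ∈ Set.range (algebraMap F E)) {p : Ideal (𝓞 F)} {Q I : Ideal (𝓞 E)}
    [Q.LiesOver p] (hI : p.map (algebraMap (𝓞 F) (𝓞 E)) ≤ I) {x : 𝓞 E}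
    (hx : τ (x : E) = x) (hxQ : x ∈ Q) : x ∈ I := by
  obtain ⟨y, rfl⟩ := exists_ringOfIntegers_of_fixed hfix hx
  exact hI (Ideal.mem_map_of_mem _ ((Ideal.mem_of_liesOver Q p y).2 hxQ))

theorem exists_mem_notMem_comap {R : Type*} [CommRing R] {Q : Ideal R}
    (hQ : Q.IsMaximal) (f : R ≃+* R) (h : Q.comap f ≠ Q) : ∃ x ∈ Q, f x ∉ Q := by
  by_contra! hc
  have hp := hQ.isPrime
  have : (Q.comap f).IsPrime := Ideal.comap_isPrime f Q
  exact h (hQ.eq_of_le this.ne_top hc).symm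

variable [NumberField E]

/-- A ramified prime of a quadratic extension is stable under the conjugation `τ`. Otherwise some
`x` would lie exactly once in `Q` with `τ x ∉ Q`, while its norm, lying in `p`, is in `Q ^ 2`. -/
theorem comap_eq_of_ramified {τ : E ≃+* E} (hτ : ∀ x, τ (τ x) = x)
    (hfix : ∀ x, τ x = x → x ∈ Set.range (algebraMap F E)) {p : Ideal (𝓞 F)} {Q : Ideal (𝓞 E)}
    [Q.LiesOver p] (hQ : Q.IsPrime) (hQ0 : Q ≠ ⊥)
    (hram : p.map (algebraMap (𝓞 F) (𝓞 E)) ≤ Q ^ 2) :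
    Q.comap (RingOfIntegers.mapRingEquiv τ) = Q := by
  by_contra hne
  obtain ⟨c, hc, hτc⟩ := exists_mem_notMem_comap (hQ.isMaximal hQ0) _ hne
  obtain ⟨x, hx, hx2, hτx⟩ : ∃ x ∈ Q, x ∉ Q ^ 2 ∧ RingOfIntegers.mapRingEquiv τ x ∉ Q := by
    obtain ⟨π, hπ, hπ2⟩ := SetLike.exists_of_lt (Ideal.pow_right_strictAnti Q hQ0 hQ.ne_top
      (by norm_num : 1 < 2))
    simp only [pow_one] at hπ hπ2
    by_cases h : RingOfIntegers.mapRingEquiv τ π ∈ Q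
    · have hc2 : c ^ 2 ∈ Q ^ 2 := Ideal.pow_mem_pow hc 2
      refine ⟨π + c ^ 2, add_mem hπ (Ideal.pow_le_self two_ne_zero hc2), ?_, ?_⟩
      · rwa [Ideal.add_mem_iff_left _ hc2]
      · rw [map_add, map_pow, Ideal.add_mem_iff_right _ h]
        exact fun h' => hτc (hQ.mem_of_pow_mem _ h')
    · exact ⟨π, hπ, hπ2, h⟩
  have hn : RingOfIntegers.mapRingEquiv τ x * x ∈ Q ^ 2 :=
    mem_of_fixed_of_mem (Q := Q) (τ := τ) hfix hram
      (by simp [hτ, mul_comm]) (Q.mul_mem_left _ hx)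
  exact (Ideal.IsPrime.mul_mem_pow Q hn).elim hτx hx2

/-- If some prime above `p` is stable under the conjugation, then it is the only prime above
`p`. -/
theorem eq_of_liesOver_of_comap_eq {τ : E ≃+* E} (hτ : ∀ x, τ (τ x) = x)
    (hfix : ∀ x, τ x = x → x ∈ Set.range (algebraMap F E)) {p : Ideal (𝓞 F)} {Q Q' : Ideal (𝓞 E)}
    [Q.LiesOver p] [Q'.LiesOver p] (hQ : Q.IsMaximal) (hQ' : Q'.IsPrime)
    (h : Q.comap (RingOfIntegers.mapRingEquiv τ) = Q) : Q' = Q := by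
  have hle : p.map (algebraMap (𝓞 F) (𝓞 E)) ≤ Q' := by
    rw [Ideal.map_le_iff_le_comap, Ideal.over_def Q' p]
  symm
  refine hQ.eq_of_le hQ'.ne_top ?_
  by_contra hne
  obtain ⟨x, hx, hx'⟩ := SetLike.not_le_iff_exists.1 hne
  have hτQ : RingOfIntegers.mapRingEquiv τ x ∈ Q := by rwa [← Ideal.mem_comap, h]
  -- Both the norm and the trace of `x` lie in `p`, so that `x ^ 2 = x * (x + τ x) - x * τ x ∈ Q'`.
  have hn : RingOfIntegers.mapRingEquiv τ x * x ∈ Q' :=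
    mem_of_fixed_of_mem (Q := Q) (τ := τ) hfix hle
      (by simp [hτ, mul_comm]) (Q.mul_mem_left _ hx)
  have ht : RingOfIntegers.mapRingEquiv τ x + x ∈ Q' :=
    mem_of_fixed_of_mem (Q := Q) (τ := τ) hfix hle
      (by simp [hτ, add_comm]) (Q.add_mem hτQ hx)
  refine hx' (hQ'.mem_of_pow_mem 2 ?_)
  have := sub_mem (Q'.mul_mem_left x ht) hn
  ring_nf at this
  exact this

/-- At a ramified prime of odd residue characteristic the conjugation acts trivially on the residue
field. -/
theorem sub_conj_mem_of_ramified {τ : E ≃+* E} (hτ : ∀ x, τ (τ x) = x)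
    (hfix : ∀ x, τ x = x → x ∈ Set.range (algebraMap F E)) {p : Ideal (𝓞 F)} {Q : Ideal (𝓞 E)}
    [Q.LiesOver p] (hQ : Q.IsPrime) (hQ0 : Q ≠ ⊥) (h2 : (2 : 𝓞 E) ∉ Q)
    (hram : p.map (algebraMap (𝓞 F) (𝓞 E)) ≤ Q ^ 2) (x : 𝓞 E) :
    x - RingOfIntegers.mapRingEquiv τ x ∈ Q := by
  by_contra hx
  have hst := comap_eq_of_ramified hτ hfix hQ hQ0 hram
  obtain ⟨π, hπ, hπ2⟩ := SetLike.exists_of_lt (Ideal.pow_right_strictAnti Q hQ0 hQ.ne_top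
    (by norm_num : 1 < 2))
  simp only [pow_one] at hπ hπ2
  have hτπ : RingOfIntegers.mapRingEquiv τ π ∈ Q := by rwa [← Ideal.mem_comap, hst]
  have ht : π + RingOfIntegers.mapRingEquiv τ π ∈ Q ^ 2 :=
    mem_of_fixed_of_mem (Q := Q) (τ := τ) hfix hram
      (by simp [hτ, add_comm]) (Q.add_mem hπ hτπ)
  -- The product of the two anti-invariant elements `x - τ x` and `π - τ π` is invariant.
  have hs : (x - RingOfIntegers.mapRingEquiv τ x) * (π - RingOfIntegers.mapRingEquiv τ π)
      ∈ Q ^ 2 :=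
    mem_of_fixed_of_mem (Q := Q) (τ := τ) hfix hram
      (by simp only [map_mul, map_sub, RingOfIntegers.mapRingEquiv_apply, hτ]; ring)
      (Q.mul_mem_left _ (Q.sub_mem hπ hτπ))
  have hs' := (Ideal.IsPrime.mul_mem_pow Q hs).resolve_left hx
  have h2π : 2 * π ∈ Q ^ 2 := by
    have := add_mem ht hs'
    ring_nf at this
    rwa [mul_comm]
  exact (Ideal.IsPrime.mul_mem_pow Q h2π).elim h2 hπ2

end Quadratic

/-! ### Reduction of roots of unity, and valuations under automorphisms -/

section Ideals

/-- Reduction modulo an ideal is injective on `m`-th roots of unity if the ideal does not contain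
`m`. -/
theorem eq_of_pow_eq_one_of_sub_mem {R : Type*} [CommRing R] [IsDomain R] {w : Ideal R}
    {m : ℕ} (hm0 : 0 < m) (hm : (m : R) ∉ w) {x y : R} (hx : x ^ m = 1) (hy : y ^ m = 1)
    (h : x - y ∈ w) : x = y := by
  obtain ⟨n, rfl⟩ : ∃ n, m = n + 1 := ⟨m - 1, by omega⟩
  have hu : (x * y ^ n) ^ (n + 1) = 1 := by
    rw [mul_pow, hx, ← pow_mul, mul_comm n, pow_mul, hy, one_pow, one_mul]
  have hu1 : x * y ^ n - 1 ∈ w := by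
    rw [← hy, show x * y ^ n - y ^ (n + 1) = (x - y) * y ^ n by ring]
    exact w.mul_mem_right _ h
  have hu' : x * y ^ n = 1 := by
    by_contra hne
    have hg := geom_sum_mul (x * y ^ n) (n + 1)
    rw [hu, sub_self] at hg
    have hg0 := (mul_eq_zero.1 hg).resolve_right (sub_ne_zero.2 hne)
    apply hm
    have hq : Ideal.Quotient.mk w (x * y ^ n) = 1 := by
      rw [← map_one (Ideal.Quotient.mk w)]
      exact Ideal.Quotient.eq.2 hu1
    have := congrArg (Ideal.Quotient.mk w) hg0
    simp only [map_sum, map_pow, hq, one_pow, map_zero] at this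
    rw [← Ideal.Quotient.eq_zero_iff_mem]
    simpa using this
  calc x = x * y ^ (n + 1) := by rw [hy, mul_one]
    _ = x * y ^ n * y := by ring
    _ = y := by rw [hu', one_mul]

theorem natCast_notMem_of_coprime {R : Type*} [CommRing R] {w : Ideal R} (hw : w ≠ ⊤) {m n : ℕ}
    (h : m.Coprime n) (hn : (n : R) ∈ w) : (m : R) ∉ w := by
  intro hm
  apply hw
  rw [Ideal.eq_top_iff_one]
  obtain ⟨u, v, huv⟩ := Nat.isCoprime_iff_coprime.2 h
  have : (1 : R) = (u : R) * m + v * n := by exact_mod_cast congrArg (Int.cast (R := R)) huv.symm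
  rw [this]
  exact add_mem (w.mul_mem_left _ hm) (w.mul_mem_left _ hn)

theorem mem_pow_iff_of_comap_eq {R : Type*} [CommRing R] {w : Ideal R} (f : R ≃+* R)
    (h : w.comap f = w) (n : ℕ) (x : R) : f x ∈ w ^ n ↔ x ∈ w ^ n := by
  have : (w ^ n).comap f = w ^ n := by
    rw [← Ideal.map_symm, Ideal.map_pow, Ideal.map_symm, h]
  rw [← Ideal.mem_comap, this]

theorem intValuation_map_of_comap_eq {R : Type*} [CommRing R] [IsDedekindDomain R]
    (w : HeightOneSpectrum R) (f : R ≃+* R) (h : w.asIdeal.comap f = w.asIdeal) (x : R) :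
    w.intValuation (f x) = w.intValuation x := by
  rcases eq_or_ne x 0 with rfl | hx
  · simp
  have hfx : f x ≠ 0 := by simpa using hx
  have key : ∀ n : ℕ, w.intValuation (f x) ≤ WithZero.exp (-(n : ℤ)) ↔
      w.intValuation x ≤ WithZero.exp (-(n : ℤ)) := fun n => by
    rw [w.intValuation_le_pow_iff_mem, w.intValuation_le_pow_iff_mem, mem_pow_iff_of_comap_eq f h]
  apply le_antisymm
  · have := w.intValuation_if_neg hx
    rw [this, key, ← this]
  · have := w.intValuation_if_neg hfx
    rw [this, ← key, ← this]

theorem valuation_map_of_comap_eq {K : Type*} [Field K] [NumberField K]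
    (w : HeightOneSpectrum (𝓞 K)) (f : K ≃+* K)
    (h : w.asIdeal.comap (RingOfIntegers.mapRingEquiv f) = w.asIdeal) (x : K) :
    w.valuation K (f x) = w.valuation K x := by
  obtain ⟨n, d, -, rfl⟩ := IsFractionRing.div_surjective (A := 𝓞 K) x
  have key : ∀ y : 𝓞 K, w.valuation K (f (algebraMap (𝓞 K) K y)) =
      w.valuation K (algebraMap (𝓞 K) K y) := fun y => by
    have : f (algebraMap (𝓞 K) K y) =
      algebraMap (𝓞 K) K (RingOfIntegers.mapRingEquiv f y) := rfl
    rw [this, w.valuation_of_algebraMap, w.valuation_of_algebraMap,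
      intValuation_map_of_comap_eq w _ h]
  rw [map_div₀, map_div₀, map_div₀, key, key]

end Ideals

/-! ### Pure cubic extensions with a conjugation -/

/-- A pure cubic extension `K = E(z)`, `z ^ 3 = a`, of a quadratic extension `E = F(ζ)` generated by
a cube root of unity, together with the conjugation `τ` of `E / F`, the generator `σ` of
`Gal(K/E)` given by `z ↦ ζ z`, and an extension `α` of `τ` to `K` with `α z = b / z`, where
`b ∈ F` and `a * τ a = b ^ 3`. That `z` generates `K` is expressed by coordinates. -/
structure PureCubic (F E K : Type*) [Field F] [Field E] [Field K] [Algebra F E] [Algebra E K] where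
  ζ : E
  ζ_eq : ζ ^ 2 + ζ + 1 = 0
  τ : E ≃+* E
  τ_algebraMap : ∀ x : F, τ (algebraMap F E x) = algebraMap F E x
  τ_ζ : τ ζ = ζ ^ 2
  exists_coords_E : ∀ e : E, ∃ x y : F, e = algebraMap F E x + algebraMap F E y * ζ
  a : E
  b : F
  b_ne_zero : b ≠ 0
  a_mul_τ_a : a * τ a = algebraMap F E b ^ 3
  isIntegral_a : IsIntegral ℤ a
  z : K
  z_pow : z ^ 3 = algebraMap E K a
  exists_coords : ∀ k : K, ∃ e₀ e₁ e₂ : E,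
    k = algebraMap E K e₀ + algebraMap E K e₁ * z + algebraMap E K e₂ * z ^ 2
  σ : K ≃+* K
  σ_algebraMap : ∀ e : E, σ (algebraMap E K e) = algebraMap E K e
  σ_z : σ z = algebraMap E K ζ * z
  α : K ≃+* K
  α_algebraMap : ∀ e : E, α (algebraMap E K e) = algebraMap E K (τ e)
  α_z : α z * z = algebraMap E K (algebraMap F E b)

namespace PureCubic

variable {F E K : Type*} [Field F] [Field E] [Field K] [Algebra F E] [Algebra E K]

section Automorphisms

variable (D : PureCubic F E K)

theorem ζ_pow : D.ζ ^ 3 = 1 := by linear_combination (D.ζ - 1) * D.ζ_eq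

theorem algebraMap_ζ_eq : algebraMap E K D.ζ ^ 2 + algebraMap E K D.ζ + 1 = 0 := by
  simpa using congrArg (algebraMap E K) D.ζ_eq

theorem z_ne_zero : D.z ≠ 0 := by
  intro h
  have := D.α_z
  rw [h, mul_zero] at this
  exact D.b_ne_zero (by simpa using this.symm)

theorem ringHom_ext {R : Type*} [CommRing R] {f g : K →+* R}
    (hE : ∀ e, f (algebraMap E K e) = g (algebraMap E K e)) (hz : f D.z = g D.z) (k : K) :
    f k = g k := by
  obtain ⟨e₀, e₁, e₂, rfl⟩ := D.exists_coords k
  simp [hE, hz]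

theorem τ_τ (e : E) : D.τ (D.τ e) = e := by
  obtain ⟨x, y, rfl⟩ := D.exists_coords_E e
  simp only [map_add, map_mul, map_pow, D.τ_algebraMap, D.τ_ζ]
  linear_combination algebraMap F E y * D.ζ * D.ζ_pow

theorem σ_σ_σ (k : K) : D.σ (D.σ (D.σ k)) = k := by
  refine D.ringHom_ext (f := ((D.σ.trans D.σ).trans D.σ).toRingHom) (g := RingHom.id K)
    (fun e => by simp [D.σ_algebraMap]) ?_ k
  have h := congrArg (algebraMap E K) D.ζ_pow
  simp only [map_pow, map_one] at h
  simp [D.σ_algebraMap, D.σ_z]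
  linear_combination D.z * h

theorem α_z_eq : D.α D.z = algebraMap E K (algebraMap F E D.b) / D.z := by
  rw [eq_div_iff D.z_ne_zero, D.α_z]

theorem b_ne_zero' : algebraMap E K (algebraMap F E D.b) ≠ 0 := by simpa using D.b_ne_zero

theorem α_α (k : K) : D.α (D.α k) = k := by
  refine D.ringHom_ext (f := (D.α.trans D.α).toRingHom) (g := RingHom.id K)
    (fun e => by simp [D.α_algebraMap, D.τ_τ]) ?_ k
  have := D.b_ne_zero'
  have := D.z_ne_zero
  simp [D.α_z_eq, D.α_algebraMap, D.τ_algebraMap]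
  field_simp

theorem α_σ (k : K) : D.α (D.σ k) = D.σ (D.α k) := by
  refine D.ringHom_ext (f := (D.σ.trans D.α).toRingHom) (g := (D.α.trans D.σ).toRingHom)
    (fun e => by simp [D.α_algebraMap, D.σ_algebraMap]) ?_ k
  have := D.z_ne_zero
  have h := congrArg (algebraMap E K) D.ζ_pow
  simp only [map_pow, map_one] at h
  have hζ : algebraMap E K D.ζ ≠ 0 := by
    rintro h0
    rw [h0] at h
    norm_num at h
  simp [D.α_z_eq, D.α_algebraMap, D.σ_algebraMap, D.σ_z, D.τ_ζ]
  field_simp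
  linear_combination algebraMap E K (algebraMap F E D.b) * h

theorem mem_range_of_τ_eq [CharZero E] (e : E) (h : D.τ e = e) :
    e ∈ Set.range (algebraMap F E) := by
  have hF : (2 : F) ≠ 0 := fun h0 => by
    have : (2 : E) = 0 := by rw [← map_ofNat (algebraMap F E) 2, h0, map_zero]
    exact two_ne_zero this
  obtain ⟨x, y, rfl⟩ := D.exists_coords_E e
  refine ⟨x - y / 2, ?_⟩
  simp only [map_add, map_mul, D.τ_algebraMap, D.τ_ζ] at h
  simp only [map_sub, map_div₀, map_ofNat]
  linear_combination (1 / 2 : E) * h - (1 / 2 : E) * algebraMap F E y * D.ζ_eq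

theorem trace_coords (e₀ e₁ e₂ : E) {k : K}
    (hk : k = algebraMap E K e₀ + algebraMap E K e₁ * D.z + algebraMap E K e₂ * D.z ^ 2) :
    k + D.σ k + D.σ (D.σ k) = 3 * algebraMap E K e₀ := by
  simp only [hk, map_add, map_mul, map_pow, D.σ_algebraMap, D.σ_z]
  linear_combination (algebraMap E K e₁ * D.z + algebraMap E K e₂ * D.z ^ 2 *
    (algebraMap E K D.ζ ^ 2 - algebraMap E K D.ζ + 1)) * D.algebraMap_ζ_eq

theorem mem_range_of_σ_eq [CharZero K] (k : K) (h : D.σ k = k) :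
    k ∈ Set.range (algebraMap E K) := by
  obtain ⟨e₀, e₁, e₂, hk⟩ := D.exists_coords k
  have h3 := D.trace_coords e₀ e₁ e₂ hk
  rw [h, h] at h3
  exact ⟨e₀, by linear_combination -(1 / 3 : K) * h3⟩

theorem isIntegral_ζ : IsIntegral ℤ D.ζ :=
  IsIntegral.of_pow (n := 3) (by norm_num) (D.ζ_pow ▸ isIntegral_one)

theorem isIntegral_z : IsIntegral ℤ D.z :=
  IsIntegral.of_pow (n := 3) (by norm_num) (D.z_pow ▸ D.isIntegral_a.algebraMap)

/-- If `F` is totally real, then `α` is complex conjugation in every complex embedding. For `z` this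
says that `φ b = |φ z| ^ 2`; both sides are real, with the same cube. -/
theorem conj_embedding [NumberField F] [IsTotallyReal F] (φ : K →+* ℂ) (k : K) :
    (starRingEnd ℂ) (φ k) = φ (D.α k) := by
  have hF : ∀ x : F, (starRingEnd ℂ) (φ (algebraMap E K (algebraMap F E x))) =
      φ (algebraMap E K (algebraMap F E x)) := fun x => by
    have := IsTotallyReal.complexEmbedding_isReal
      ((φ.comp (algebraMap E K)).comp (algebraMap F E))
    exact RingHom.congr_fun this x
  have hζ : (starRingEnd ℂ) (φ (algebraMap E K D.ζ)) = φ (algebraMap E K D.ζ) ^ 2 := by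
    have h3 : φ (algebraMap E K D.ζ) ^ 3 = 1 := by
      rw [← map_pow, ← map_pow, D.ζ_pow, map_one, map_one]
    have hn : ‖φ (algebraMap E K D.ζ)‖ = 1 := Complex.norm_eq_one_of_pow_eq_one h3 (by norm_num)
    have h1 := Complex.conj_mul' (φ (algebraMap E K D.ζ))
    rw [hn] at h1
    push_cast at h1
    linear_combination φ (algebraMap E K D.ζ) ^ 2 * h1 -
      (starRingEnd ℂ) (φ (algebraMap E K D.ζ)) * h3
  have hE : ∀ e : E, (starRingEnd ℂ) (φ (algebraMap E K e)) = φ (algebraMap E K (D.τ e)) := by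
    intro e
    obtain ⟨x, y, rfl⟩ := D.exists_coords_E e
    simp [hF, hζ, D.τ_algebraMap, D.τ_ζ]
  refine D.ringHom_ext (f := (starRingEnd ℂ).comp φ) (g := φ.comp D.α.toRingHom)
    (fun e => by simp [hE, D.α_algebraMap]) ?_ k
  set β := φ (algebraMap E K (algebraMap F E D.b)) with hβ
  obtain ⟨r, hr⟩ := Complex.conj_eq_iff_real.1 (hF D.b)
  have hz := Complex.conj_mul' (φ D.z)
  have hcube : ((‖φ D.z‖ : ℂ) ^ 2) ^ 3 = β ^ 3 := by
    rw [← hz, mul_pow, ← map_pow, ← map_pow, D.z_pow, hE, hβ, ← map_mul, ← map_mul, ← map_pow,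
      ← map_pow, mul_comm, D.a_mul_τ_a]
  rw [← hβ] at hr
  rw [hr] at hcube
  have hreal : ‖φ D.z‖ ^ 2 = r :=
    (Odd.strictMono_pow (R := ℝ) (n := 3) (by decide)).injective (by exact_mod_cast hcube)
  have hz0 : φ D.z ≠ 0 := by simpa using D.z_ne_zero
  simp only [RingHom.comp_apply, RingEquiv.toRingHom_eq_coe, RingEquiv.coe_toRingHom]
  rw [← mul_left_inj' hz0, hz, ← map_mul, D.α_z, ← hβ, hr, ← hreal]
  push_cast
  rfl

end Automorphisms
end PureCubic

/-! ### Integrality of unitary elements -/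

/-- The element `e` of `E` is integral over the ring of `S`-integers of `F`, expressed by
denominators: at each prime outside `S` it has a denominator in `F` prime to it. -/
def IsIntegralOutside {F E : Type*} [Field F] [NumberField F] [Field E] [Algebra F E]
    (S : Set (HeightOneSpectrum (𝓞 F))) (e : E) : Prop :=
  ∀ p ∉ S, ∃ d : 𝓞 F, d ∉ p.asIdeal ∧ IsIntegral ℤ (algebraMap F E d * e)

namespace PureCubic

section Primes

variable {F E K : Type*} [Field F] [Field E] [Field K] [Algebra F E] [Algebra E K]
  (D : PureCubic F E K)

theorem σ_mul_σ_mul_σ_σ (k : K) : D.σ (k * D.σ k * D.σ (D.σ k)) = k * D.σ k * D.σ (D.σ k) := by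
  simp only [map_mul, D.σ_σ_σ]
  ring

theorem exists_ringOfIntegers_of_σ_eq [NumberField K] {k : 𝓞 K} (h : D.σ (k : K) = k) :
    ∃ e : 𝓞 E, algebraMap (𝓞 E) (𝓞 K) e = k :=
  exists_ringOfIntegers_of_fixed D.mem_range_of_σ_eq h

theorem α_algebraMap_integer (e : 𝓞 E) :
    RingOfIntegers.mapRingEquiv D.α (algebraMap (𝓞 E) (𝓞 K) e) =
      algebraMap (𝓞 E) (𝓞 K) (RingOfIntegers.mapRingEquiv D.τ e) :=
  RingOfIntegers.ext (D.α_algebraMap e)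

/-- A prime of `E` is stable under `τ` if it lies above a prime of `F` which does not split. -/
theorem comap_τ_eq [NumberField E] {p : HeightOneSpectrum (𝓞 F)} (hp : RamifiedIn E p ∨ NonSplitIn E p)
    {Q : Ideal (𝓞 E)} (hQ : Q.IsPrime) [hQp : Q.LiesOver p.asIdeal] :
    Q.comap (RingOfIntegers.mapRingEquiv D.τ) = Q := by
  rcases hp with ⟨Q₀, ⟨hQ₀, hQ₀p⟩, hram⟩ | ⟨Q₀, -, huniq⟩
  · have h0 : Q₀ ≠ ⊥ := Ideal.ne_bot_of_liesOver_of_ne_bot p.ne_bot Q₀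
    have hst := comap_eq_of_ramified D.τ_τ D.mem_range_of_τ_eq hQ₀ h0 hram
    rwa [eq_of_liesOver_of_comap_eq D.τ_τ D.mem_range_of_τ_eq (p := p.asIdeal)
      (hQ₀.isMaximal h0) hQ hst]
  · have h : Q.comap (RingOfIntegers.mapRingEquiv D.τ) ∈ p.asIdeal.primesOver (𝓞 E) := by
      refine ⟨Ideal.comap_isPrime _ Q, ⟨?_⟩⟩
      rw [hQp.over]
      ext x
      have : RingOfIntegers.mapRingEquiv D.τ (algebraMap (𝓞 F) (𝓞 E) x) =
        algebraMap (𝓞 F) (𝓞 E) x := RingOfIntegers.ext (D.τ_algebraMap x)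
      simp only [Ideal.under, Ideal.mem_comap, this]
    rw [huniq _ h, huniq Q ⟨hQ, hQp⟩]

/-- A prime of `K` is stable under `α` if its restriction to `E` is stable under `τ`. The primes of
`K` above a prime of `E` are permuted transitively by `σ`, which has order three and commutes with
the involution `α`. -/
theorem comap_α_eq [NumberField K] {w : Ideal (𝓞 K)} (hw : w.IsMaximal)
    (hQ : (w.under (𝓞 E)).comap (RingOfIntegers.mapRingEquiv D.τ) = w.under (𝓞 E)) :
    w.comap (RingOfIntegers.mapRingEquiv D.α) = w := by
  have hwp := hw.isPrime
  set α := RingOfIntegers.mapRingEquiv D.α with hα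
  set σ := RingOfIntegers.mapRingEquiv D.σ with hσ
  have hσ3 : ∀ x, σ (σ (σ x)) = x := fun x => RingOfIntegers.ext (D.σ_σ_σ x)
  have hα2 : ∀ x, α (α x) = x := fun x => RingOfIntegers.ext (D.α_α x)
  have hασ : ∀ x, α (σ x) = σ (α x) := fun x => RingOfIntegers.ext (D.α_σ x)
  -- It suffices that `w` is stable under `α ∘ s` for some power `s` of `σ`.
  have key : ∀ s : 𝓞 K ≃+* 𝓞 K, (∀ x, s (s (s x)) = x) → (∀ x, α (s x) = s (α x)) →
      w ≤ (w.comap α).comap s → w.comap α = w := by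
    intro s hs3 hαs hle
    have : ((w.comap α).comap s).IsPrime := Ideal.comap_isPrime _ _
    have heq := hw.eq_of_le this.ne_top hle
    have h1 : ∀ x, x ∈ w ↔ α (s x) ∈ w := fun x => by
      conv_lhs => rw [heq]
      rfl
    have h2 : ∀ x, x ∈ w ↔ s (s x) ∈ w := fun x => by
      rw [h1, h1, hαs (α _), hα2]
    have h3 : ∀ x, x ∈ w ↔ s x ∈ w := fun x => by
      rw [h2, h2, hs3]
    ext x
    rw [Ideal.mem_comap, h3, ← hαs, ← h1]
  have hcover : ((w : Set (𝓞 K)) ⊆ ⋃ i ∈ ((Finset.univ : Finset (Fin 3)) : Set (Fin 3)),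
      (![w.comap α, (w.comap α).comap σ, (w.comap α).comap (σ.trans σ)] i : Ideal (𝓞 K))) := by
    intro x hx
    obtain ⟨e, he⟩ := D.exists_ringOfIntegers_of_σ_eq (k := x * σ x * σ (σ x))
      (D.σ_mul_σ_mul_σ_σ x)
    have heQ : e ∈ w.under (𝓞 E) := by
      rw [Ideal.under, Ideal.mem_comap, he]
      exact w.mul_mem_right _ (w.mul_mem_right _ hx)
    rw [← hQ, Ideal.mem_comap, Ideal.under, Ideal.mem_comap, ← D.α_algebraMap_integer, he, ← hα,
      map_mul, map_mul] at heQ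
    simp only [Finset.coe_univ, Set.mem_univ, Set.iUnion_true, Set.mem_iUnion, SetLike.mem_coe]
    rcases hwp.mem_or_mem heQ with h | h
    · rcases hwp.mem_or_mem h with h | h
      · exact ⟨0, h⟩
      · exact ⟨1, h⟩
    · exact ⟨2, h⟩
  obtain ⟨i, -, hi⟩ := (Ideal.subset_union_prime 0 0 (by
    intro i _ _ _
    fin_cases i <;> exact Ideal.comap_isPrime _ _)).1 hcover
  fin_cases i
  · exact key (RingEquiv.refl _) (fun _ => rfl) (fun _ => rfl) hi
  · exact key σ hσ3 hασ hi
  · exact key (σ.trans σ) (fun x => by simp [hσ3]) (fun x => by simp [hασ]) hi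

theorem isIntegral_mul_coords {e₀ e₁ e₂ d : E} (h₀ : IsIntegral ℤ (d * e₀))
    (h₁ : IsIntegral ℤ (d * e₁)) (h₂ : IsIntegral ℤ (d * e₂)) :
    IsIntegral ℤ (algebraMap E K d *
      (algebraMap E K e₀ + algebraMap E K e₁ * D.z + algebraMap E K e₂ * D.z ^ 2)) := by
  have h := (h₀.algebraMap (B := K)).add
    (((h₁.algebraMap (B := K)).mul D.isIntegral_z).add
      ((h₂.algebraMap (B := K)).mul (D.isIntegral_z.pow 2)))
  simp only [map_mul] at h
  exact (congrArg (IsIntegral ℤ) (by ring)).mp h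

theorem exists_common_denom [NumberField F] {S : Set (HeightOneSpectrum (𝓞 F))} {e₀ e₁ e₂ : E}
    (h₀ : IsIntegralOutside S e₀) (h₁ : IsIntegralOutside S e₁) (h₂ : IsIntegralOutside S e₂)
    {p : HeightOneSpectrum (𝓞 F)} (hp : p ∉ S) :
    ∃ d : 𝓞 F, d ∉ p.asIdeal ∧ IsIntegral ℤ (algebraMap F E d * e₀) ∧
      IsIntegral ℤ (algebraMap F E d * e₁) ∧ IsIntegral ℤ (algebraMap F E d * e₂) := by
  obtain ⟨d₀, hd₀, hi₀⟩ := h₀ p hp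
  obtain ⟨d₁, hd₁, hi₁⟩ := h₁ p hp
  obtain ⟨d₂, hd₂, hi₂⟩ := h₂ p hp
  have hint : ∀ d : 𝓞 F, IsIntegral ℤ (algebraMap F E d) := fun d => d.2.algebraMap
  refine ⟨d₀ * d₁ * d₂, fun h => ?_, ?_, ?_, ?_⟩
  · exact (p.isPrime.mem_or_mem h).elim (fun h => (p.isPrime.mem_or_mem h).elim hd₀ hd₁) hd₂
  · exact (congrArg (IsIntegral ℤ) (by simp only [map_mul]; ring)).mp
      (((hint d₁).mul (hint d₂)).mul hi₀)
  · exact (congrArg (IsIntegral ℤ) (by simp only [map_mul]; ring)).mp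
      (((hint d₀).mul (hint d₂)).mul hi₁)
  · exact (congrArg (IsIntegral ℤ) (by simp only [map_mul]; ring)).mp
      (((hint d₀).mul (hint d₁)).mul hi₂)

variable [NumberField F] [NumberField E] [NumberField K]

/-- The prime of `F` below a maximal ideal of the integers of `K`. -/
noncomputable def primeBelow (F E : Type*) {K : Type*} [Field F] [Field E] [Field K] [Algebra F E]
    [Algebra E K] [NumberField F] [NumberField E] [NumberField K] {w : Ideal (𝓞 K)}
    (hw : w.IsMaximal) (hw0 : w ≠ ⊥) : HeightOneSpectrum (𝓞 F) where
  asIdeal := (w.under (𝓞 E)).under (𝓞 F)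
  isPrime := by
    have := hw.isPrime
    infer_instance
  ne_bot := by
    have h : w.under (𝓞 E) ≠ ⊥ := Ideal.IsIntegral.comap_ne_bot _ hw0
    exact Ideal.IsIntegral.comap_ne_bot _ h

/-- Elements of `K` with `α k * k = 1` whose coordinates are integral outside a set `S` of primes
which do not split in `E` are integral: at primes above `S` the valuations of `k` and `α k`
agree. -/
theorem isIntegral_of_α_mul_self {S : Set (HeightOneSpectrum (𝓞 F))}
    (hS : ∀ p ∈ S, RamifiedIn E p ∨ NonSplitIn E p) {e₀ e₁ e₂ : E}
    (h₀ : IsIntegralOutside S e₀) (h₁ : IsIntegralOutside S e₁) (h₂ : IsIntegralOutside S e₂)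
    {k : K} (hk : k = algebraMap E K e₀ + algebraMap E K e₁ * D.z + algebraMap E K e₂ * D.z ^ 2)
    (hα : D.α k * k = 1) : IsIntegral ℤ k := by
  suffices h : k ∈ (algebraMap (𝓞 K) K).range by
    obtain ⟨x, rfl⟩ := h
    exact x.2
  refine HeightOneSpectrum.mem_integers_of_valuation_le_one K k fun w => ?_
  have hw := w.isMaximal
  set p := primeBelow F E hw w.ne_bot
  have : (w.asIdeal.under (𝓞 E)).LiesOver p.asIdeal := ⟨rfl⟩
  have hwp := w.isPrime
  by_cases hpS : p ∈ S
  · have hst := D.comap_α_eq hw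
      (D.comap_τ_eq (hS p hpS) (Q := w.asIdeal.under (𝓞 E)) inferInstance)
    have hv := valuation_map_of_comap_eq w D.α hst k
    have h1 := congrArg (w.valuation K) hα
    rw [map_mul, hv, map_one, ← sq] at h1
    exact ((pow_eq_one_iff_of_nonneg (zero_le) two_ne_zero).1 h1).le
  · obtain ⟨d, hd, hi₀, hi₁, hi₂⟩ := exists_common_denom h₀ h₁ h₂ hpS
    obtain ⟨y, hy⟩ : ∃ y : 𝓞 K, (y : K) = algebraMap E K (algebraMap F E d) * k :=
      ⟨⟨_, hk ▸ D.isIntegral_mul_coords hi₀ hi₁ hi₂⟩, rfl⟩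
    have hdw : w.valuation K (algebraMap E K (algebraMap F E d)) = 1 := by
      have : algebraMap E K (algebraMap F E d) =
        algebraMap (𝓞 K) K (algebraMap (𝓞 E) (𝓞 K) (algebraMap (𝓞 F) (𝓞 E) d)) := rfl
      rw [this, HeightOneSpectrum.valuation_eq_one_iff_notMem]
      exact hd
    have hle : w.valuation K (y : K) ≤ 1 := w.valuation_le_one y
    rwa [hy, map_mul, hdw, one_mul] at hle

end Primes
end PureCubic

namespace PureCubic

/-! ### Roots of unity in the unitary group -/

section RootsOfUnity

variable {F E K : Type*} [Field F] [Field E] [Field K] [Algebra F E] [Algebra E K]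
  (D : PureCubic F E K)

theorem eq_of_pow_three_eq_one {x : K} (hx : x ^ 3 = 1) :
    x = 1 ∨ x = algebraMap E K D.ζ ∨ x = algebraMap E K D.ζ ^ 2 := by
  have h : (x - 1) * ((x - algebraMap E K D.ζ) * (x - algebraMap E K D.ζ ^ 2)) = 0 := by
    have h3 := congrArg (algebraMap E K) D.ζ_pow
    simp only [map_pow, map_one] at h3
    linear_combination hx - (x ^ 2 - x) * D.algebraMap_ζ_eq + (x - 1) * h3
  rcases mul_eq_zero.1 h with h | h
  · exact .inl (sub_eq_zero.1 h)
  · exact .inr ((mul_eq_zero.1 h).imp sub_eq_zero.1 sub_eq_zero.1)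

/-- If `x ^ 3` lies in `E`, then `σ x` and `x` differ by a cube root of unity, so that `x ^ 3` is
the norm of `x`. -/
theorem pow_three_eq_one_of_norm_eq_one (r : ℕ) : ∀ x : K, x ^ 3 ^ r = 1 →
    x * D.σ x * D.σ (D.σ x) = 1 → x ^ 3 = 1 := by
  induction r with
  | zero =>
    intro x hx _
    rw [pow_zero, pow_one] at hx
    rw [hx, one_pow]
  | succ r ih =>
    intro x hx hN
    have h9 : (x ^ 3) ^ 3 = 1 := by
      refine ih (x ^ 3) (by rw [← pow_mul, ← pow_succ', hx]) ?_
      rw [map_pow, map_pow, ← mul_pow, ← mul_pow, hN, one_pow]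
    have hσ : D.σ (x ^ 3) = x ^ 3 := by
      rcases D.eq_of_pow_three_eq_one h9 with h | h | h <;> rw [h] <;>
        simp [D.σ_algebraMap]
    have hx0 : x ≠ 0 := by
      rintro rfl
      simp at hN
    have hq : (D.σ x / x) ^ 3 = 1 := by
      rw [div_pow, ← map_pow, hσ, div_self (pow_ne_zero 3 hx0)]
    obtain ⟨c, hc, hcσ, hcx⟩ : ∃ c : K, c ^ 3 = 1 ∧ D.σ c = c ∧ D.σ x = c * x := by
      refine ⟨D.σ x / x, hq, ?_, by field_simp⟩
      rcases D.eq_of_pow_three_eq_one hq with h | h | h <;> rw [h] <;>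
        simp [D.σ_algebraMap]
    rw [hcx, map_mul, hcσ, hcx] at hN
    linear_combination hN - x ^ 3 * hc

variable [NumberField K]

/-- A root of unity of order prime to three with `α x = x⁻¹` and norm one is trivial, provided that
`τ` acts trivially on the residue field of `E` below some prime above three: modulo this prime `α x`
is a conjugate of `x` over `E`, so that it is equal to this conjugate. -/
theorem eq_one_of_trivial_action {w : Ideal (𝓞 K)} (hw : w.IsPrime) (h3 : (3 : 𝓞 K) ∈ w)
    (hτ : ∀ e : 𝓞 E, e - RingOfIntegers.mapRingEquiv D.τ e ∈ w.under (𝓞 E)) {m : ℕ} (hm0 : 0 < m)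
    (hm : m.Coprime 3) {x : 𝓞 K} (hx : x ^ m = 1) (hα : D.α x * x = 1)
    (hN : (x : K) * D.σ x * D.σ (D.σ x) = 1) : x = 1 := by
  set α := RingOfIntegers.mapRingEquiv D.α with hα_def
  set σ := RingOfIntegers.mapRingEquiv D.σ with hσ_def
  have hσ3 : ∀ x, σ (σ (σ x)) = x := fun x => RingOfIntegers.ext (D.σ_σ_σ x)
  have hα2 : ∀ x, α (α x) = x := fun x => RingOfIntegers.ext (D.α_α x)
  have hασ : ∀ x, α (σ x) = σ (α x) := fun x => RingOfIntegers.ext (D.α_σ x)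
  have hmw : (m : 𝓞 K) ∉ w := natCast_notMem_of_coprime hw.ne_top hm (by exact_mod_cast h3)
  have hfix : ∀ s : 𝓞 K, σ s = s → s - α s ∈ w := by
    intro s hs
    obtain ⟨e, rfl⟩ := D.exists_ringOfIntegers_of_σ_eq (congrArg (algebraMap (𝓞 K) K) hs)
    rw [hα_def, D.α_algebraMap_integer, ← map_sub]
    exact hτ e
  -- The coefficients of `(X - x) (X - σ x) (X - σ² x)` agree modulo `w` with those of its
  -- `α`-conjugate, of which `α x` is a root.
  have hmem : (α x - x) * ((α x - σ x) * (α x - σ (σ x))) ∈ w := by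
    have h1 := hfix (x + σ x + σ (σ x)) (by simp only [map_add, hσ3]; ring)
    have h2 := hfix (x * σ x + σ x * σ (σ x) + σ (σ x) * x)
      (by simp only [map_add, map_mul, hσ3]; ring)
    have h3 := hfix (x * σ x * σ (σ x)) (by simp only [map_mul, hσ3]; ring)
    have := sub_mem (sub_mem (w.mul_mem_left (α x) h2) (w.mul_mem_left (α x ^ 2) h1)) h3
    convert this using 1
    simp only [map_add, map_mul, hασ]
    ring
  have hαx : α x ^ m = 1 := by rw [← map_pow, hx, map_one]
  have hσx : σ x ^ m = 1 := by rw [← map_pow, hx, map_one]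
  have hσσx : σ (σ x) ^ m = 1 := by rw [← map_pow, hσx, map_one]
  have heq : α x = x := by
    rcases hw.mem_or_mem hmem with h | h
    · exact eq_of_pow_eq_one_of_sub_mem hm0 hmw hαx hx h
    rcases hw.mem_or_mem h with h | h
    · have h := eq_of_pow_eq_one_of_sub_mem hm0 hmw hαx hσx h
      have h' : σ (σ x) = x := by rw [← h, ← hασ, ← h, hα2]
      rw [h]
      conv_rhs => rw [← hσ3 x, h']
    · have h := eq_of_pow_eq_one_of_sub_mem hm0 hmw hαx hσσx h
      have h' : σ x = x := by
        calc σ x = σ (σ (α x)) := by rw [h, hσ3]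
          _ = α (α x) := by rw [h, hασ, hασ, h, ← h]
          _ = x := hα2 x
      rw [h, h', h']
  have hsq : (x - 1) * (x + 1) = 0 := by
    have : x * x = 1 := by
      have h : α x * x = 1 := RingOfIntegers.ext hα
      rwa [heq] at h
    linear_combination this
  rcases mul_eq_zero.1 hsq with h | h
  · exact sub_eq_zero.1 h
  · have hneg : (x : K) = -1 := by
      have := eq_neg_of_add_eq_zero_left h
      rw [this]
      simp
    rw [hneg] at hN
    simp only [map_neg, map_one] at hN
    norm_num at hN

variable [NumberField F] [NumberField E] [IsTotallyReal F]

/-- The elements of norm one of the unitary group of `K` with respect to `α` that are integral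
outside a set of non-split primes, where the primes above three are ramified, are cube roots of
unity. -/
theorem pow_three_eq_one {S : Set (HeightOneSpectrum (𝓞 F))}
    (hS : ∀ p ∈ S, RamifiedIn E p ∨
      (¬ RamifiedIn E p ∧ NonSplitIn E p ∧ (3 : 𝓞 F) ∉ p.asIdeal)) {e₀ e₁ e₂ : E}
    (h₀ : IsIntegralOutside S e₀) (h₁ : IsIntegralOutside S e₁) (h₂ : IsIntegralOutside S e₂)
    {k : K} (hk : k = algebraMap E K e₀ + algebraMap E K e₁ * D.z + algebraMap E K e₂ * D.z ^ 2)
    (hα : D.α k * k = 1) (hN : k * D.σ k * D.σ (D.σ k) = 1) : k ^ 3 = 1 := by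
  have hint : IsIntegral ℤ k := D.isIntegral_of_α_mul_self
    (fun p hp => (hS p hp).imp id fun h => h.2.1) h₀ h₁ h₂ hk hα
  obtain ⟨n, hn0, hn⟩ : ∃ (n : ℕ) (_ : 0 < n), k ^ n = 1 := by
    refine Embeddings.pow_eq_one_of_norm_eq_one K ℂ hint fun φ => ?_
    have h := Complex.conj_mul' (φ k)
    rw [D.conj_embedding, ← map_mul, hα, map_one] at h
    have h' : ‖φ k‖ ^ 2 = 1 := by exact_mod_cast h.symm
    exact (pow_eq_one_iff_of_nonneg (norm_nonneg _) two_ne_zero).1 h'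
  obtain ⟨r, m, hm3, hnm⟩ := Nat.exists_eq_pow_mul_and_not_dvd hn0.ne' 3 (by norm_num)
  have hm0 : 0 < m := Nat.pos_of_ne_zero fun h => hn0.ne' (by rw [hnm, h, mul_zero])
  have hm : m.Coprime 3 := ((Nat.Prime.coprime_iff_not_dvd Nat.prime_three).2 hm3).symm
  refine D.pow_three_eq_one_of_norm_eq_one r k ?_ hN
  obtain ⟨x, rfl⟩ : ∃ x : 𝓞 K, (x : K) = k := ⟨⟨k, hint⟩, rfl⟩
  have hcoe : ((x ^ 3 ^ r : 𝓞 K) : K) = (x : K) ^ 3 ^ r := rfl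
  have hNr : (x : K) ^ 3 ^ r * D.σ ((x : K) ^ 3 ^ r) * D.σ (D.σ ((x : K) ^ 3 ^ r)) = 1 := by
    rw [map_pow, map_pow, ← mul_pow, ← mul_pow, hN, one_pow]
  suffices h : x ^ 3 ^ r = 1 by rw [← map_pow, h, map_one]
  have hxm : (x ^ 3 ^ r) ^ m = 1 := by
    rw [← pow_mul, ← hnm]
    exact RingOfIntegers.ext (by simpa using hn)
  -- A prime of `K` above three.
  obtain ⟨w, hw, h3w⟩ : ∃ w : Ideal (𝓞 K), w.IsMaximal ∧ (3 : 𝓞 K) ∈ w := by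
    apply exists_max_ideal_of_mem_nonunits
    intro h
    have hi : IsUnit (algebraMap ℤ (𝓞 K) 3) := by simpa using h
    exact absurd (isUnit_of_map_unit _ _ hi) (by decide)
  have hw0 : w ≠ ⊥ := by
    rintro rfl
    exact OfNat.ofNat_ne_zero 3 (Ideal.mem_bot.1 h3w)
  have hwp := hw.isPrime
  have hmw : (m : 𝓞 K) ∉ w := natCast_notMem_of_coprime hw.ne_top hm (by exact_mod_cast h3w)
  set p := primeBelow F E hw hw0
  have hQp : (w.under (𝓞 E)).LiesOver p.asIdeal := ⟨rfl⟩
  have hp3 : (3 : 𝓞 F) ∈ p.asIdeal := by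
    change algebraMap (𝓞 E) (𝓞 K) (algebraMap (𝓞 F) (𝓞 E) 3) ∈ w
    rwa [map_ofNat, map_ofNat]
  by_cases hpS : p ∈ S
  · obtain ⟨Q₀, ⟨hQ₀, hQ₀p⟩, hram⟩ := (hS p hpS).resolve_right fun h => h.2.2 hp3
    have h0 : Q₀ ≠ ⊥ := Ideal.ne_bot_of_liesOver_of_ne_bot p.ne_bot Q₀
    have hst := comap_eq_of_ramified D.τ_τ D.mem_range_of_τ_eq hQ₀ h0 hram
    have hQ := eq_of_liesOver_of_comap_eq D.τ_τ D.mem_range_of_τ_eq (p := p.asIdeal)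
      (Q' := w.under (𝓞 E)) (hQ₀.isMaximal h0) inferInstance hst
    refine D.eq_one_of_trivial_action hwp h3w (fun e => ?_) hm0 hm hxm ?_ ?_
    · rw [hQ]
      refine sub_conj_mem_of_ramified D.τ_τ D.mem_range_of_τ_eq hQ₀ h0 ?_ hram e
      have h3Q : (3 : 𝓞 E) ∈ Q₀ := by
        rw [← hQ]
        change algebraMap (𝓞 E) (𝓞 K) 3 ∈ w
        rwa [map_ofNat]
      exact_mod_cast natCast_notMem_of_coprime hQ₀.ne_top (by norm_num : Nat.Coprime 2 3)
        (by exact_mod_cast h3Q)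
    · rw [hcoe, map_pow, ← mul_pow, hα, one_pow]
    · rwa [hcoe]
  · obtain ⟨d, hd, hi₀, hi₁, hi₂⟩ := exists_common_denom h₀ h₁ h₂ hpS
    set ζ : 𝓞 K := ⟨algebraMap E K D.ζ, D.isIntegral_ζ.algebraMap⟩ with hζ
    have hζw : 1 - ζ ∈ w := by
      refine hwp.mem_of_pow_mem 2 ?_
      have : (1 - ζ) ^ 2 = -ζ * 3 := by
        refine RingOfIntegers.ext ?_
        simp only [map_pow, map_sub, map_mul, map_neg, map_one, map_ofNat]
        change (1 - algebraMap E K D.ζ) ^ 2 = -algebraMap E K D.ζ * 3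
        linear_combination D.algebraMap_ζ_eq
      rw [this]
      exact w.mul_mem_left _ h3w
    -- The coordinates of `x` are integral at `w`, and `σ` acts on `z` by a root of unity that is
    -- trivial modulo `w`.
    have hσx : x - RingOfIntegers.mapRingEquiv D.σ x ∈ w := by
      set d' : 𝓞 K := algebraMap (𝓞 E) (𝓞 K) (algebraMap (𝓞 F) (𝓞 E) d) with hd'
      have hd'w : d' ∉ w := hd
      obtain ⟨y, hy⟩ : ∃ y : 𝓞 K, (y : K) = algebraMap E K (algebraMap F E d) *
          (algebraMap E K e₁ * D.z + algebraMap E K e₂ * (1 + algebraMap E K D.ζ) * D.z ^ 2) := by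
        suffices h : IsIntegral ℤ (algebraMap E K (algebraMap F E d) * (algebraMap E K e₁ * D.z +
            algebraMap E K e₂ * (1 + algebraMap E K D.ζ) * D.z ^ 2)) from ⟨⟨_, h⟩, rfl⟩
        have := ((hi₁.algebraMap (B := K)).mul D.isIntegral_z).add
          (((hi₂.algebraMap (B := K)).mul (isIntegral_one.add
            (D.isIntegral_ζ.algebraMap (B := K)))).mul (D.isIntegral_z.pow 2))
        simp only [map_mul] at this
        exact (congrArg (IsIntegral ℤ) (by ring)).mp this
      have hprod : d' * (x - RingOfIntegers.mapRingEquiv D.σ x) = y * (1 - ζ) := by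
        refine RingOfIntegers.ext ?_
        simp only [map_mul, map_sub, map_one, RingOfIntegers.mapRingEquiv_apply, hy]
        change algebraMap E K (algebraMap F E d) * ((x : K) - D.σ x) = _ * (1 - algebraMap E K D.ζ)
        rw [hk]
        simp only [map_add, map_mul, map_pow, D.σ_algebraMap, D.σ_z]
        ring
      exact (hwp.mem_or_mem (hprod ▸ w.mul_mem_left y hζw)).resolve_left hd'w
    have hfix : x ^ 3 ^ r = RingOfIntegers.mapRingEquiv D.σ (x ^ 3 ^ r) := by
      refine eq_of_pow_eq_one_of_sub_mem hm0 hmw hxm (by rw [← map_pow, hxm, map_one]) ?_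
      rw [map_pow]
      exact Ideal.mem_of_dvd _ (sub_dvd_pow_sub_pow _ _ _) hσx
    have hfixK : D.σ ((x : K) ^ 3 ^ r) = (x : K) ^ 3 ^ r :=
      (congrArg (algebraMap (𝓞 K) K) hfix).symm
    rw [hfixK, hfixK, ← hcoe] at hNr
    have h3 : (x ^ 3 ^ r) ^ 3 = 1 := by
      refine RingOfIntegers.ext (Eq.trans ?_ hNr)
      change ((x ^ 3 ^ r : 𝓞 K) : K) ^ 3 = _
      ring
    exact (pow_eq_one_iff_of_coprime hm).1 ⟨hxm, h3⟩

end RootsOfUnity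
end PureCubic

namespace PureCubic

/-! ### Construction and coordinates -/

section Construction

open Polynomial

variable {F E : Type*} [Field F] [Field E] [Algebra F E]

theorem exists_coords_adjoinRoot {a : E} (k : AdjoinRoot (X ^ 3 - C a)) : ∃ e₀ e₁ e₂ : E,
    k = algebraMap E _ e₀ + algebraMap E _ e₁ * AdjoinRoot.root (X ^ 3 - C a) +
      algebraMap E _ e₂ * AdjoinRoot.root (X ^ 3 - C a) ^ 2 := by
  have hm : (X ^ 3 - C a).Monic := monic_X_pow_sub_C a (by norm_num)
  have : Nontrivial (AdjoinRoot (X ^ 3 - C a)) :=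
    AdjoinRoot.nontrivial _ (by rw [degree_X_pow_sub_C (by norm_num)]; norm_num)
  obtain ⟨p, hp, rfl⟩ := (AdjoinRoot.powerBasis' hm).exists_eq_aeval k
  rw [AdjoinRoot.powerBasis'_dim, natDegree_X_pow_sub_C] at hp
  refine ⟨p.coeff 0, p.coeff 1, p.coeff 2, ?_⟩
  rw [AdjoinRoot.powerBasis'_gen]
  conv_lhs => rw [p.as_sum_range_C_mul_X_pow' hp]
  simp [Finset.sum_range_succ]

/-- The pure cubic extension `E[X] / (X ^ 3 - a)`, for `a` not a cube in `E`. -/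
noncomputable def ofNotCube (ζ : E) (hζ : ζ ^ 2 + ζ + 1 = 0) (τ : E ≃ₐ[F] E) (hτ : τ ζ = ζ ^ 2)
    (hE : ∀ e : E, ∃ x y : F, e = algebraMap F E x + algebraMap F E y * ζ) (a : E) (b : F)
    (hb : b ≠ 0) (hab : a * τ a = algebraMap F E b ^ 3) (ha : IsIntegral ℤ a)
    [Fact (Irreducible (X ^ 3 - C a))] : PureCubic F E (AdjoinRoot (X ^ 3 - C a)) :=
  have ha0 : a ≠ 0 := by
    rintro rfl
    rw [zero_mul] at hab
    exact hb (by simpa using hab.symm)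
  have hz : AdjoinRoot.root (X ^ 3 - C a) ^ 3 = AdjoinRoot.of _ a := by
    have := AdjoinRoot.eval₂_root (X ^ 3 - C a)
    simpa [sub_eq_zero] using this
  have hz0 : AdjoinRoot.root (X ^ 3 - C a) ≠ 0 := by
    intro h
    rw [h, zero_pow three_ne_zero] at hz
    exact ha0 (by simpa using hz.symm)
  have hζ3 : ζ ^ 3 = 1 := by linear_combination (ζ - 1) * hζ
  have hττ : ∀ e, τ (τ e) = e := by
    intro e
    obtain ⟨x, y, rfl⟩ := hE e
    simp only [map_add, map_mul, map_pow, AlgEquiv.commutes, hτ]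
    linear_combination algebraMap F E y * ζ * hζ3
  let σ : AdjoinRoot (X ^ 3 - C a) →+* AdjoinRoot (X ^ 3 - C a) :=
    AdjoinRoot.lift (AdjoinRoot.of _) (AdjoinRoot.of _ ζ * AdjoinRoot.root _) (by
      simp [mul_pow, hz, ← map_pow, hζ3])
  have hσ : ∀ e, σ (AdjoinRoot.of _ e) = AdjoinRoot.of _ e := fun e => AdjoinRoot.lift_of _
  have hσz : σ (AdjoinRoot.root _) = AdjoinRoot.of _ ζ * AdjoinRoot.root _ :=
    AdjoinRoot.lift_root _
  have hσ3 : (σ.comp σ).comp σ = RingHom.id _ :=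
    AdjoinRoot.ringHom_ext (by ext e; simp [hσ]) (by
      have h := congrArg (AdjoinRoot.of (X ^ 3 - C a)) hζ3
      simp only [map_pow, map_one] at h
      simp [hσ, hσz]
      linear_combination AdjoinRoot.root (X ^ 3 - C a) * h)
  let α : AdjoinRoot (X ^ 3 - C a) →+* AdjoinRoot (X ^ 3 - C a) :=
    AdjoinRoot.lift ((AdjoinRoot.of _).comp τ.toRingEquiv.toRingHom)
      (AdjoinRoot.of _ (algebraMap F E b) / AdjoinRoot.root _) (by
        have h := congrArg (AdjoinRoot.of (X ^ 3 - C a)) hab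
        simp only [map_mul, map_pow] at h
        have h0 : AdjoinRoot.of (X ^ 3 - C a) a ≠ 0 := by simpa using ha0
        simp [div_pow, hz]
        field_simp
        linear_combination -h)
  have hα : ∀ e, α (AdjoinRoot.of _ e) = AdjoinRoot.of _ (τ e) := fun e => AdjoinRoot.lift_of _
  have hαz : α (AdjoinRoot.root _) =
      AdjoinRoot.of _ (algebraMap F E b) / AdjoinRoot.root _ := AdjoinRoot.lift_root _
  have hα2 : α.comp α = RingHom.id _ :=
    AdjoinRoot.ringHom_ext (by ext e; simp [hα, hττ]) (by
      have h0 : AdjoinRoot.of (X ^ 3 - C a) (algebraMap F E b) ≠ 0 := by simpa using hb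
      simp only [RingHom.comp_apply, hαz, map_div₀, hα, AlgEquiv.commutes, RingHom.id_apply]
      field_simp)
  { ζ := ζ
    ζ_eq := hζ
    τ := τ.toRingEquiv
    τ_algebraMap := τ.commutes
    τ_ζ := hτ
    exists_coords_E := hE
    a := a
    b := b
    b_ne_zero := hb
    a_mul_τ_a := hab
    isIntegral_a := ha
    z := AdjoinRoot.root _
    z_pow := hz
    exists_coords := exists_coords_adjoinRoot
    σ := RingEquiv.ofRingHom σ (σ.comp σ) hσ3 hσ3
    σ_algebraMap := hσ
    σ_z := hσz
    α := RingEquiv.ofRingHom α α hα2 hα2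
    α_algebraMap := hα
    α_z := by
      change α (AdjoinRoot.root _) * AdjoinRoot.root _ = _
      rw [hαz, div_mul_cancel₀ _ hz0]
      rfl }

theorem numberField_adjoinRoot [NumberField E] (a : E) [Fact (Irreducible (X ^ 3 - C a))] :
    NumberField (AdjoinRoot (X ^ 3 - C a)) := by
  have : Module.Finite E (AdjoinRoot (X ^ 3 - C a)) :=
    (monic_X_pow_sub_C a (by norm_num)).finite_adjoinRoot
  exact NumberField.of_module_finite E _

end Construction

section Coordinates

variable {F E K : Type*} [Field F] [Field E] [Field K] [Algebra F E] [Algebra E K]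
  (D : PureCubic F E K)

theorem norm_coords (e₀ e₁ e₂ : E) {k : K}
    (hk : k = algebraMap E K e₀ + algebraMap E K e₁ * D.z + algebraMap E K e₂ * D.z ^ 2) :
    k * D.σ k * D.σ (D.σ k) =
      algebraMap E K (e₀ ^ 3 + D.a * e₁ ^ 3 + D.a ^ 2 * e₂ ^ 3 - 3 * D.a * e₀ * e₁ * e₂) := by
  have h1 := D.algebraMap_ζ_eq
  have h2 : algebraMap E K D.ζ ^ 2 = -1 - algebraMap E K D.ζ := by linear_combination h1
  have hσ : D.σ k = algebraMap E K e₀ + algebraMap E K D.ζ * (algebraMap E K e₁ * D.z) +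
      (-1 - algebraMap E K D.ζ) * (algebraMap E K e₂ * D.z ^ 2) := by
    rw [hk, ← h2]
    simp only [map_add, map_mul, map_pow, D.σ_algebraMap, D.σ_z]
    ring
  have hσσ : D.σ (D.σ k) = algebraMap E K e₀ +
      (-1 - algebraMap E K D.ζ) * (algebraMap E K e₁ * D.z) +
      algebraMap E K D.ζ * (algebraMap E K e₂ * D.z ^ 2) := by
    rw [hσ]
    simp only [map_add, map_mul, map_pow, map_sub, map_neg, map_one, D.σ_algebraMap, D.σ_z]
    linear_combination (algebraMap E K e₁ * D.z -
      algebraMap E K D.ζ * algebraMap E K e₂ * D.z ^ 2) * h1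
  rw [hσσ, hσ, hk]
  simp only [map_add, map_sub, map_mul, map_pow, map_ofNat, ← D.z_pow]
  linear_combination -(algebraMap E K e₀ + algebraMap E K e₁ * D.z + algebraMap E K e₂ * D.z ^ 2) *
    (algebraMap E K e₁ * D.z - algebraMap E K e₂ * D.z ^ 2) ^ 2 * h1

/-- The equation `α k * k = 1`, in coordinates. -/
theorem α_mul_self_eq_one {e₀ e₁ e₂ : E}
    (h₀ : D.τ e₀ * e₀ + algebraMap F E D.b ^ 2 * D.τ e₂ * e₂ +
      algebraMap F E D.b * D.τ e₁ * e₁ = 1)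
    (h₁ : D.a * D.τ e₀ * e₁ + algebraMap F E D.b ^ 2 * D.τ e₂ * e₀ +
      D.a * algebraMap F E D.b * D.τ e₁ * e₂ = 0)
    (h₂ : D.a * D.τ e₀ * e₂ + algebraMap F E D.b ^ 2 * D.τ e₂ * e₁ +
      algebraMap F E D.b * D.τ e₁ * e₀ = 0) {k : K}
    (hk : k = algebraMap E K e₀ + algebraMap E K e₁ * D.z + algebraMap E K e₂ * D.z ^ 2) :
    D.α k * k = 1 := by
  have h₀ := congrArg (algebraMap E K) h₀
  have h₁ := congrArg (algebraMap E K) h₁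
  have h₂ := congrArg (algebraMap E K) h₂
  simp only [map_add, map_mul, map_pow, map_one, map_zero, ← D.z_pow] at h₀ h₁ h₂
  have hz := D.z_ne_zero
  rw [hk]
  simp only [map_add, map_mul, map_pow, D.α_algebraMap, D.α_z_eq]
  field_simp
  linear_combination D.z ^ 2 * h₀ + h₁ + D.z * h₂

theorem coords_eq_zero [CharZero K] {e₀ e₁ e₂ : E}
    (h : algebraMap E K e₀ + algebraMap E K e₁ * D.z + algebraMap E K e₂ * D.z ^ 2 = 0) :
    e₀ = 0 ∧ e₁ = 0 ∧ e₂ = 0 := by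
  have first : ∀ {f₀ f₁ f₂ : E},
      algebraMap E K f₀ + algebraMap E K f₁ * D.z + algebraMap E K f₂ * D.z ^ 2 = 0 → f₀ = 0 := by
    intro f₀ f₁ f₂ hf
    have := D.trace_coords f₀ f₁ f₂ hf.symm
    simpa using this
  have hz := D.z_ne_zero
  have h₀ := first h
  have h' : algebraMap E K e₁ + algebraMap E K e₂ * D.z = 0 := by
    rw [h₀, map_zero] at h
    refine (mul_eq_zero.1 (?_ : D.z * _ = 0)).resolve_left hz
    linear_combination h
  have h₁ : e₁ = 0 := first (f₁ := e₂) (f₂ := 0) (by rw [map_zero]; linear_combination h')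
  refine ⟨h₀, h₁, ?_⟩
  rw [h₁, map_zero, zero_add] at h'
  simpa [hz] using h'

end Coordinates
end PureCubic

namespace CyclicPresentation

variable {F E L : Type*} [Field F] [Field E] [Field L]
  [Algebra F E] [Algebra E L] [Algebra F L] [IsScalarTower F E L]

/-! ### The tower `L / E / F` and the cyclic algebra -/

section Conjugation

variable (P : CyclicPresentation F E L)

/-- The restriction of `τ` to `E` is a non-trivial automorphism of `E / F`. -/
theorem exists_conj :
    ∃ τ : E ≃ₐ[F] E, (∀ e, algebraMap E L (τ e) = P.τ (algebraMap E L e)) ∧ τ ≠ 1 := by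
  have := P.isGalois
  have := P.finiteDimensional_L
  have : Algebra.IsQuadraticExtension F E := { finrank_eq_two' := P.finrank_E }
  have : FiniteDimensional F E :=
    FiniteDimensional.of_finrank_pos (by rw [P.finrank_E]; norm_num)
  refine ⟨P.τ.restrictNormal E, AlgEquiv.restrictNormal_commutes P.τ E, fun h => ?_⟩
  have hfix : ∀ e : E, P.τ (algebraMap E L e) = algebraMap E L e := fun e => by
    rw [← AlgEquiv.restrictNormal_commutes, h]
    rfl
  -- An element of order two of `Gal(L/F)` that fixes `E` would be an element of order two of
  -- `Gal(L/E)`, a group of order three.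
  let t : L ≃ₐ[E] L := AlgEquiv.ofRingEquiv (f := P.τ.toRingEquiv) hfix
  have h3 : t ^ 3 = 1 := by
    have := pow_card_eq_one' (x := t)
    rwa [P.card_gal_EL] at this
  have h1 : P.τ = 1 := by
    ext x
    have : P.τ (P.τ (P.τ x)) = x := congrArg (fun f : L ≃ₐ[E] L => f x) h3
    rwa [P.τ_τ] at this
  have h' := P.orderOf_τ
  rw [h1, orderOf_one] at h'
  omega

theorem exists_algebraMap_eq_of_ρ_eq {l : L} (h : P.ρ l = l) : ∃ e : E, algebraMap E L e = l := by
  have := P.isGalois_EL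
  refine (InfiniteGalois.mem_range_algebraMap_iff_fixed l).2 fun f => ?_
  have : Fact (Nat.Prime 3) := ⟨Nat.prime_three⟩
  obtain ⟨n, rfl⟩ := mem_zpowers_of_prime_card P.card_gal_EL P.ρ_ne_one (g' := f)
  have hmem : P.ρ ∈ MulAction.stabilizer (L ≃ₐ[E] L) l := h
  exact Subgroup.zpow_mem _ hmem n

theorem exists_coords_of_adjoin_eq_top {ζ : E} (hζ : ζ ^ 2 + ζ + 1 = 0)
    (hE : IntermediateField.adjoin F {ζ} = ⊤) (e : E) :
    ∃ x y : F, e = algebraMap F E x + algebraMap F E y * ζ := by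
  have hint : IsIntegral F ζ := by
    refine IsIntegral.of_pow (n := 3) (by norm_num) ?_
    rw [show ζ ^ 3 = 1 by linear_combination (ζ - 1) * hζ]
    exact isIntegral_one
  have he : e ∈ Algebra.adjoin F {ζ} := by
    rw [← IntermediateField.adjoin_simple_toSubalgebra_of_isAlgebraic hint.isAlgebraic, hE]
    trivial
  induction he using Algebra.adjoin_induction with
  | mem x hx => exact ⟨0, 1, by simp [Set.mem_singleton_iff.1 hx]⟩
  | algebraMap r => exact ⟨r, 0, by simp⟩
  | add x y _ _ hx hy =>
    obtain ⟨a, b, rfl⟩ := hx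
    obtain ⟨c, d, rfl⟩ := hy
    exact ⟨a + c, b + d, by simp only [map_add]; ring⟩
  | mul x y _ _ hx hy =>
    obtain ⟨a, b, rfl⟩ := hx
    obtain ⟨c, d, rfl⟩ := hy
    refine ⟨a * c - b * d, a * d + b * c - b * d, ?_⟩
    simp only [map_add, map_sub, map_mul]
    linear_combination algebraMap F E b * algebraMap F E d * hζ

theorem conj_eq_sq {ζ : E} (hζ : ζ ^ 2 + ζ + 1 = 0) (hE : IntermediateField.adjoin F {ζ} = ⊤)
    {τ : E ≃ₐ[F] E} (hτ : τ ≠ 1) : τ ζ = ζ ^ 2 := by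
  have h := congrArg τ hζ
  simp only [map_add, map_pow, map_one, map_zero] at h
  have h' : (τ ζ - ζ) * (τ ζ - ζ ^ 2) = 0 := by
    linear_combination h + (ζ - 1 - τ ζ) * hζ
  refine sub_eq_zero.1 ((mul_eq_zero.1 h').resolve_left fun h0 => hτ ?_)
  ext e
  obtain ⟨x, y, rfl⟩ := exists_coords_of_adjoin_eq_top hζ hE e
  simp [sub_eq_zero.1 h0]

/-- If `a = c ^ 3`, then `(z - c) * (z ^ 2 + c * z + c ^ 2) = 0`. -/
theorem pow_three_ne_a (hD : ∀ x : P.Alg, x ≠ 0 → IsUnit x) (c : E) : c ^ 3 ≠ P.a := by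
  intro hc
  let x : P.Alg := ⟨-algebraMap E L c, 1, 0⟩
  let y : P.Alg := ⟨algebraMap E L c ^ 2, algebraMap E L c, 1⟩
  have ha : P.aL = algebraMap E L c ^ 3 := by rw [aL, ← hc, map_pow]
  have hxy : x * y = 0 := by
    ext
    · simp [x, y, ha]
      ring
    · simp [x, y]
      ring
    · simp [x, y]
  have hx : x ≠ 0 := fun h => one_ne_zero (congrArg Alg.l₁ h)
  have hy : y ≠ 0 := fun h => one_ne_zero (congrArg Alg.l₂ h)
  exact hy ((hD x hx).mul_right_eq_zero.1 hxy)

end Conjugation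

/-! ### The order `𝔬_L(S)` and the trivial points -/

section Integers

variable [NumberField F]

/-- An element of `E ∩ 𝔬_L(S)` is integral over the `S`-integers of `F`: a sum of products of
`S`-integers of `F` and integers of `L` has denominators in `F`. -/
theorem isIntegralOutside_of_mem_integersL {S : Set (HeightOneSpectrum (𝓞 F))} {e : E}
    (he : algebraMap E L e ∈ integersL F L S) : IsIntegralOutside S e := by
  intro p hp
  suffices h : ∀ l ∈ integersL F L S,
      ∃ d : 𝓞 F, d ∉ p.asIdeal ∧ IsIntegral ℤ (algebraMap F L d * l) by
    obtain ⟨d, hd, hi⟩ := h _ he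
    refine ⟨d, hd, ?_⟩
    rw [← isIntegral_algebraMap_iff (algebraMap E L).injective, map_mul,
      ← IsScalarTower.algebraMap_apply]
    exact hi
  have hint : ∀ d : 𝓞 F, IsIntegral ℤ (algebraMap F L d) := fun d => d.2.algebraMap
  intro l hl
  induction hl using Submodule.span_induction with
  | mem x hx =>
    obtain ⟨y, rfl⟩ := hx
    refine ⟨1, p.isPrime.one_notMem, ?_⟩
    exact (hint 1).mul y.2
  | zero => exact ⟨1, p.isPrime.one_notMem, by simpa using isIntegral_zero⟩
  | add x y _ _ hx hy =>
    obtain ⟨d, hd, hi⟩ := hx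
    obtain ⟨d', hd', hi'⟩ := hy
    refine ⟨d * d', fun h => (p.isPrime.mem_or_mem h).elim hd hd', ?_⟩
    have := ((hint d').mul hi).add ((hint d).mul hi')
    exact (congrArg (IsIntegral ℤ) (by simp only [map_mul]; ring)).mp this
  | smul s x _ hx =>
    obtain ⟨d, hd, hi⟩ := hx
    obtain ⟨n, d', hnd⟩ := HeightOneSpectrum.exists_primeCompl_mul_eq_of_integer (K := F) p
      (s : F) (s.2 p hp)
    refine ⟨d * d', fun h => (p.isPrime.mem_or_mem h).elim hd d'.2, ?_⟩
    have h1 : algebraMap F L (d * d' : 𝓞 F) * (s • x) =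
        algebraMap F L n * (algebraMap F L d * x) := by
      have h2 := congrArg (algebraMap F L) hnd
      rw [map_mul] at h2
      rw [Algebra.smul_def, IsScalarTower.algebraMap_apply (S.integer F) F L, ← h2]
      simp only [map_mul]
      change _ * (algebraMap F L (s : F) * x) = _
      ring
    rw [h1]
    exact (hint n).mul hi

theorem mem_integersL_of_isIntegral (S : Set (HeightOneSpectrum (𝓞 F))) {l : L}
    (hl : IsIntegral ℤ l) : l ∈ integersL F L S :=
  Submodule.subset_span ⟨⟨l, hl⟩, rfl⟩

/-- Cube roots of unity `e` in `E` with `τ e = e⁻¹` are `ρ`-fixed points of the unitary group. -/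
theorem ofL_mem {P : CyclicPresentation F E L} (S : Set (HeightOneSpectrum (𝓞 F))) {e : E}
    (h3 : e ^ 3 = 1) (hτ : P.τ (algebraMap E L e) * algebraMap E L e = 1) :
    Alg.ofL P (algebraMap E L e) ∈ P.specialUnitaryPoints S ∧
      (Alg.ofL P (algebraMap E L e)).rhoAct = Alg.ofL P (algebraMap E L e) := by
  have hi : IsIntegral ℤ (algebraMap E L e) :=
    (IsIntegral.of_pow (n := 3) (by norm_num) (h3 ▸ isIntegral_one)).algebraMap
  refine ⟨⟨⟨mem_integersL_of_isIntegral S hi, Submodule.zero_mem _, Submodule.zero_mem _⟩,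
    ?_, ?_⟩, ?_⟩
  · ext <;> simp [Alg.ofL, star, hτ]
  · have := congrArg (algebraMap E L) h3
    simp only [map_pow, map_one] at this
    simp [Alg.reducedNorm, Alg.toMatrix, Alg.ofL, Matrix.det_fin_three, ← this]
    ring
  · ext <;> simp [Alg.rhoAct, Alg.ofL]

end Integers

end CyclicPresentation

/-! ### The fixed points -/

open CyclicPresentation in
theorem mainTheorem6
    {F E L : Type*} [Field F] [Field E] [Field L]
    [NumberField F] [NumberField E] [NumberField L]
    [Algebra F E] [Algebra E L] [Algebra F L] [IsScalarTower F E L]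
    [NumberField.IsTotallyReal F]
    (P : CyclicPresentation F E L)
    -- `D` is a division algebra
    (hD : ∀ x : P.Alg, x ≠ 0 → IsUnit x)
    -- `E = F(ζ)` for a primitive third root of unity `ζ`
    (ζ : E) (hζ : IsPrimitiveRoot ζ 3) (hE : IntermediateField.adjoin F {ζ} = ⊤)
    -- `a` is a unit of `𝔬_E` and `b` is a unit of `𝔬_F`
    (ha : ∃ u : (𝓞 E)ˣ, ((u : 𝓞 E) : E) = P.a)
    (hb : ∃ u : (𝓞 F)ˣ, algebraMap F L ((u : 𝓞 F) : F) = P.bL)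
    (S : Set (HeightOneSpectrum (𝓞 F)))
    (hS : ∀ p ∈ S, RamifiedIn E p ∨
      (¬ RamifiedIn E p ∧ NonSplitIn E p ∧ (3 : 𝓞 F) ∉ p.asIdeal)) :
    {g : P.Alg | g ∈ P.specialUnitaryPoints S ∧ g.rhoAct = g} =
      {1, CyclicPresentation.Alg.ofL P (algebraMap E L ζ),
        CyclicPresentation.Alg.ofL P (P.τ (algebraMap E L ζ))} := by
  have hζ2 : ζ ^ 2 + ζ + 1 = 0 := by
    have h := hζ.geom_sum_eq_zero (by norm_num)
    simp only [Finset.sum_range_succ, Finset.sum_range_zero] at h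
    linear_combination h
  have hζ3 : ζ ^ 3 = 1 := hζ.pow_eq_one
  obtain ⟨τ, hτL, hτ1⟩ := P.exists_conj
  have hτζ := conj_eq_sq hζ2 hE hτ1
  have hτζL : P.τ (algebraMap E L ζ) = algebraMap E L (ζ ^ 2) := by rw [← hτL, hτζ]
  have h1 : (1 : P.Alg) = Alg.ofL P (algebraMap E L 1) := by rw [map_one]; rfl
  rw [hτζL, h1]
  ext g
  simp only [Set.mem_ofPred_eq, Set.mem_insert_iff, Set.mem_singleton_iff]
  constructor
  swap
  · rintro (rfl | rfl | rfl)
    · exact ofL_mem S (one_pow 3) (by simp)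
    · exact ofL_mem S hζ3 (by rw [hτζL, ← map_mul, ← pow_succ, hζ3, map_one])
    · refine ofL_mem S (by rw [← pow_mul, mul_comm, pow_mul, hζ3, one_pow]) ?_
      rw [← hτL, map_pow, hτζ, ← map_mul,
        show (ζ ^ 2) ^ 2 * ζ ^ 2 = (ζ ^ 3) ^ 2 by ring, hζ3, one_pow, map_one]
  rintro ⟨⟨⟨hi₀, hi₁, hi₂⟩, hstar, hnorm⟩, hρ⟩
  obtain ⟨l₀, l₁, l₂⟩ := g
  obtain ⟨e₀, rfl⟩ := P.exists_algebraMap_eq_of_ρ_eq (congrArg Alg.l₀ hρ)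
  obtain ⟨e₁, rfl⟩ := P.exists_algebraMap_eq_of_ρ_eq (congrArg Alg.l₁ hρ)
  obtain ⟨e₂, rfl⟩ := P.exists_algebraMap_eq_of_ρ_eq (congrArg Alg.l₂ hρ)
  obtain ⟨u, hu⟩ := ha
  obtain ⟨v, hv⟩ := hb
  set b : F := ((v : 𝓞 F) : F) with hbdef
  have hb0 : b ≠ 0 := by simp [hbdef]
  have hbL : P.bL = algebraMap E L (algebraMap F E b) := by
    rw [← hv]
    exact IsScalarTower.algebraMap_apply F E L b
  have hab : (P.a : E) * τ P.a = algebraMap F E b ^ 3 := by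
    apply (algebraMap E L).injective
    have h := P.norm_eq'
    rw [hbL] at h
    simp only [AlgEquiv.commutes] at h
    rw [map_mul, hτL, map_pow]
    exact h.trans (by ring)
  have hirr : Fact (Irreducible (Polynomial.X ^ 3 - Polynomial.C (P.a : E))) :=
    ⟨X_pow_sub_C_irreducible_of_prime Nat.prime_three (P.pow_three_ne_a hD)⟩
  have hK := PureCubic.numberField_adjoinRoot (P.a : E)
  set D := PureCubic.ofNotCube ζ hζ2 τ hτζ (exists_coords_of_adjoin_eq_top hζ2 hE) P.a b hb0 hab
    (hu ▸ u.1.2)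
  have hDa : D.a = P.a := rfl
  have hDζ : D.ζ = ζ := rfl
  have haL : P.aL = algebraMap E L P.a := rfl
  have ha0 : algebraMap E L P.a ≠ 0 := by simp
  -- The equations `α(g) g = 1` and `Nrd(g) = 1`, in terms of the coordinates of `g`.
  have hs₀ : τ e₀ * e₀ + algebraMap F E b ^ 2 * τ e₂ * e₂ + algebraMap F E b * τ e₁ * e₁ = 1 := by
    apply (algebraMap E L).injective
    have h := congrArg Alg.l₀ hstar
    simp [star, ← hτL, hbL, haL] at h
    field_simp at h
    simp only [map_add, map_mul, map_pow, map_one]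
    linear_combination h
  have hs₁ : P.a * τ e₀ * e₁ + algebraMap F E b ^ 2 * τ e₂ * e₀ +
      P.a * algebraMap F E b * τ e₁ * e₂ = 0 := by
    apply (algebraMap E L).injective
    have h := congrArg Alg.l₁ hstar
    simp [star, ← hτL, hbL, haL] at h
    field_simp at h
    simp only [map_add, map_mul, map_pow, map_zero]
    linear_combination h
  have hs₂ : P.a * τ e₀ * e₂ + algebraMap F E b ^ 2 * τ e₂ * e₁ +
      algebraMap F E b * τ e₁ * e₀ = 0 := by
    apply (algebraMap E L).injective
    have h := congrArg Alg.l₂ hstar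
    simp [star, ← hτL, hbL, haL] at h
    field_simp at h
    simp only [map_add, map_mul, map_pow, map_zero]
    linear_combination h
  have hn : e₀ ^ 3 + P.a * e₁ ^ 3 + (P.a : E) ^ 2 * e₂ ^ 3 - 3 * P.a * e₀ * e₁ * e₂ = 1 := by
    apply (algebraMap E L).injective
    simp [Alg.reducedNorm, Alg.toMatrix, Matrix.det_fin_three, haL] at hnorm
    simp only [map_add, map_sub, map_mul, map_pow, map_one, map_ofNat]
    linear_combination hnorm
  obtain ⟨k, hk⟩ : ∃ k, k = algebraMap E _ e₀ + algebraMap E _ e₁ * D.z +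
    algebraMap E _ e₂ * D.z ^ 2 := ⟨_, rfl⟩
  have hα : D.α k * k = 1 := D.α_mul_self_eq_one hs₀ hs₁ hs₂ hk
  have hN : k * D.σ k * D.σ (D.σ k) = 1 := by
    rw [D.norm_coords e₀ e₁ e₂ hk, hDa, hn, map_one]
  have hcube := D.pow_three_eq_one hS (isIntegralOutside_of_mem_integersL hi₀)
    (isIntegralOutside_of_mem_integersL hi₁) (isIntegralOutside_of_mem_integersL hi₂) hk hα hN
  have hfin : ∀ c : E, k = algebraMap E _ c →
      (⟨algebraMap E L e₀, algebraMap E L e₁, algebraMap E L e₂⟩ : P.Alg) =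
        Alg.ofL P (algebraMap E L c) := by
    intro c hc
    obtain ⟨h₀, rfl, rfl⟩ := D.coords_eq_zero (e₀ := e₀ - c) (e₁ := e₁) (e₂ := e₂) (by
      rw [map_sub]
      linear_combination hc - hk)
    rw [sub_eq_zero.1 h₀, map_zero]
    rfl
  rcases D.eq_of_pow_three_eq_one hcube with h | h | h
  · exact .inl (hfin 1 (by rw [h, map_one]))
  · exact .inr (.inl (hfin ζ h))
  · exact .inr (.inr (hfin (ζ ^ 2) (by rw [h, map_pow, hDζ])))
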